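/- Let $d\ge 2$ be an integer and, for $\varepsilon>0$, let $\mathcal G_\varepsilon^d\subset\mathbb R^d$ be the $d$-dimensional cubic metric grid of edgelength $\varepsilon$, i.e. the metric graph with vertex set $\varepsilon\mathbb Z^d$ whose edges are the segments (of length $\varepsilon$, each counted once) joining two vertices at distance $\varepsilon$. Integrals over $\mathcal G_\varepsilon^d$ are sums over all edges of one-dimensional Lebesgue integrals in arc length. Let $H^1(\mathcal G_\varepsilon^d)$ be the space of continuous functions $u:\mathcal G_\varepsilon^d\to\mathbb R$ having a weak derivative $u'$ on every edge with $u,u'\in L^2(\mathcal G_\varepsilon^d)$, and for $m>0$ let $$H^1_m(\mathcal G_\varepsilon^d):=\{u\in H^1(\mathcal G_\varepsilon^d):\ \|u\|_{L^2(\mathcal G_\varepsilon^d)}^2=m\}.$$ For $p>2$ define the energy $$\widetilde E_{\mathcal G_\varepsilon^d}(u):=\frac12\|u'\|_{L^2(\mathcal G_\varepsilon^d)}^2-\frac1{dp}\|u\|_{L^p(\mathcal G_\varepsilon^d)}^p ,\qquad u\in H^1(\mathcal G_\varepsilon^d).$$ A function $u\in H^1_m(\mathcal G_\varepsilon^d)$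 is called a ground state of $\widetilde E_{\mathcal G_\varepsilon^d}$ at mass $m$ if $\widetilde E_{\mathcal G_\varepsilon^d}(u)=\inf_{v\in H^1_m(\mathcal G_\varepsilon^d)}\widetilde E_{\mathcal G_\varepsilon^d}(v)$. **Theorem 5.2.** For every $p\in\left(2,2+\frac4d\right)$ and $\mu>0$ there exist $\bar\varepsilon>0$ and $C>0$, depending only on $p$, $\mu$ and $d$, such that, for every $\varepsilon\in(0,\bar\varepsilon)$, if $u\in H^1_{\frac{d}{\varepsilon^{d-1}}\mu}(\mathcal G_\varepsilon^d)$ is a ground state of $\widetilde E_{\mathcal G_\varepsilon^d}$ at mass $\frac{d}{\varepsilon^{d-1}}\mu$, then $$\frac1C\le \varepsilon^{d-1}\|u'\|_{L^2(\mathcal G_\varepsilon^d)}^2\le C,\qquad \frac1C\le \varepsilon^{d-1}\|u\|_{L^p(\mathcal G_\varepsilon^d)}^p\le C .$$ -/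

import Mathlib

noncomputable section

namespace MetricGrid

open MeasureTheory Set
open scoped ENNReal ContDiff

/-- Each edge of the cubic grid is listed exactly once: `(k, i)` is the segment joining the
neighbouring vertices `ε k` and `ε (k + eᵢ)`, `k ∈ ℤ^d`. -/
abbrev Edge (d : ℕ) : Type := (Fin d → ℤ) × Fin d

/-- The vertex `ε k` of the grid. -/
def vertex {d : ℕ} (ε : ℝ) (k : Fin d → ℤ) : EuclideanSpace ℝ (Fin d) :=
  WithLp.toLp 2 fun j => ε * (k j : ℝ)

/-- Arc-length parametrization `t ↦ ε k + t eᵢ` of the edge `(k, i)`, for `t ∈ [0, ε]`. -/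
def edgePoint {d : ℕ} (ε : ℝ) (e : Edge d) (t : ℝ) : EuclideanSpace ℝ (Fin d) :=
  vertex ε e.1 + t • EuclideanSpace.single e.2 (1 : ℝ)

/-- The `d`-dimensional cubic grid of edgelength `ε`, as a subset (with the induced topology)
of `ℝ^d`: the union of all its edges. -/
def grid (d : ℕ) (ε : ℝ) : Set (EuclideanSpace ℝ (Fin d)) :=
  {x | ∃ e : Edge d, ∃ t ∈ Icc (0 : ℝ) ε, edgePoint ε e t = x}

/-- The restriction of a function on the grid to the edge `e`, in the arc-length coordinate
`t ∈ [0, ε]` (by convention `0` for other `t`; these values are never used). -/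
def onEdge {d : ℕ} {ε : ℝ} (u : grid d ε → ℝ) (e : Edge d) (t : ℝ) : ℝ :=
  if h : t ∈ Icc (0 : ℝ) ε then u ⟨edgePoint ε e t, e, t, h, rfl⟩ else 0

/-- `g` is a weak derivative of `f` on the open interval `(a, b)`. -/
def IsWeakDeriv (f g : ℝ → ℝ) (a b : ℝ) : Prop :=
  ∀ φ : ℝ → ℝ, ContDiff ℝ ∞ φ → HasCompactSupport φ → tsupport φ ⊆ Ioo a b →
    ∫ t in Ioo a b, f t * deriv φ t = -∫ t in Ioo a b, g t * φ t

/-- `∑ₑ ∫₀^ε |fₑ(t)|^q dt ∈ [0, ∞]`: the `q`-th power of the `L^q` norm, on the grid of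
edgelength `ε`, of a function given edge by edge. -/
def lpPow {d : ℕ} (ε q : ℝ) (f : Edge d → ℝ → ℝ) : ℝ≥0∞ :=
  ∑' e : Edge d, ∫⁻ t in Ioo (0 : ℝ) ε, ‖f e t‖ₑ ^ q

/-- The Sobolev space `H¹` of the grid: continuous real functions `u` on the grid, with a weak
derivative `u'` on every edge, such that `u` and `u'` are square integrable on the grid. The
field `der` is a representative of `u'`, which is unique up to null sets. -/
structure H1 (d : ℕ) (ε : ℝ) where
  /-- the function `u` -/
  toFun : grid d ε → ℝ
  /-- (a representative of) the weak derivative `u'`, edge by edge -/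
  der : Edge d → ℝ → ℝ
  continuous_toFun : Continuous toFun
  aestronglyMeasurable_der : ∀ e, AEStronglyMeasurable (der e) (volume.restrict (Ioo 0 ε))
  isWeakDeriv : ∀ e, IsWeakDeriv (onEdge toFun e) (der e) 0 ε
  lpPow_toFun_lt_top : lpPow ε 2 (onEdge toFun) < ⊤
  lpPow_der_lt_top : lpPow ε 2 der < ⊤

variable {d : ℕ} {ε : ℝ}

/-- `‖u‖_{L^q}^q` on the grid. -/
def H1.normPow (q : ℝ) (u : H1 d ε) : ℝ := (lpPow ε q (onEdge u.toFun)).toReal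

/-- `‖u'‖_{L²}²` on the grid. -/
def H1.derNormSq (u : H1 d ε) : ℝ := (lpPow ε 2 u.der).toReal

/-- The space `H¹_m` of `H¹` functions of mass `‖u‖_{L²}² = m`. -/
def H1mass (d : ℕ) (ε m : ℝ) : Set (H1 d ε) := {u | u.normPow 2 = m}

/-- The energy `½ ‖u'‖_{L²}² - (1/(d p)) ‖u‖_{L^p}^p`. -/
def energy (p : ℝ) (u : H1 d ε) : ℝ :=
  1 / 2 * u.derNormSq - 1 / ((d : ℝ) * p) * u.normPow p

/-- `u` is an energy ground state at mass `m`: it belongs to `H¹_m` and attains the infimum of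
the energy over `H¹_m`. -/
def IsGroundState (p m : ℝ) (u : H1 d ε) : Prop :=
  u ∈ H1mass d ε m ∧ IsMinOn (energy p) (H1mass d ε m) u

end MetricGrid

end

/-! Write `s = ε ^ (d - 1)`, `A = s‖u'‖₂²`, `N = s‖u‖ₚᵖ` and `b = d(p - 2)/4`; subcriticality of `p`
means `0 < b < 1`. Two facts, both uniform in `ε`, suffice: (i) `N ≤ K A ^ b` at the prescribed mass
(`exists_normPow_le_mul_rpow`); (ii) for small `ε` some competitor has `s` times its energy at most
`-c < 0` (`exists_energy_le`). Minimality and (ii) give `d p c + (d p / 2) A ≤ N`, and (i) bounds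
the right side by `K A ^ b`. Hence `N` is bounded below, and so is `A` by (i). As `b < 1`, `A` is
bounded above, and then so is `N`.

For (i), `|u| ^ γ` at a vertex is bounded by its variation along each of the `d` grid lines through
it, because `u` is square integrable along the line. A Loomis–Whitney type inequality on `ℤ^d` turns
this into a Sobolev inequality for `|u| ^ γ`. Cauchy–Schwarz and interpolation then yield the
Gagliardo–Nirenberg inequality at the mass-critical exponent `2 + 4/d` (`lpPow_critical_le`).
Interpolating with the mass reaches `p`, and all powers of `ε` cancel at mass `d μ / s`.

For (ii), a bump is spread over a large macroscopic radius that does not depend on `ε`. Since `p` is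
subcritical, the potential term there dominates the kinetic one. -/

noncomputable section

namespace MetricGrid

open MeasureTheory Set
open scoped ENNReal ContDiff

/-! ### Weak derivatives and absolute continuity on an interval. -/

/-- The primitive, based at the left endpoint, of a smooth function supported in `(a, b)` with
zero integral is a smooth function supported in `(a, b)`. -/
theorem exists_testFunction_deriv_eq {a b : ℝ} {χ : ℝ → ℝ} (hχ : ContDiff ℝ ∞ χ)
    (hK : HasCompactSupport χ) (hs : tsupport χ ⊆ Ioo a b) (h0 : ∫ t in Ioo a b, χ t = 0) :
    ∃ φ : ℝ → ℝ, ContDiff ℝ ∞ φ ∧ HasCompactSupport φ ∧ tsupport φ ⊆ Ioo a b ∧ deriv φ = χ := by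
  have hcont : Continuous χ := hχ.continuous
  rcases (tsupport χ).eq_empty_or_nonempty with he | hne
  · refine ⟨0, contDiff_zero_fun, HasCompactSupport.zero, by simp [tsupport], ?_⟩
    have : χ = 0 := by simpa [tsupport] using he
    rw [this]; ext x; simp
  obtain ⟨a', ha'm, ha'⟩ := hK.isCompact.exists_isLeast hne
  obtain ⟨b', hb'm, hb'⟩ := hK.isCompact.exists_isGreatest hne
  have haa := hs ha'm
  have hbb := hs hb'm
  have hz : ∀ x, x ∉ Icc a' b' → χ x = 0 := fun x hx => by
    by_contra h
    have : x ∈ tsupport χ := subset_tsupport _ h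
    exact hx ⟨ha' this, hb' this⟩
  have hd : ∀ x, HasDerivAt (fun t => ∫ s in a..t, χ s) (χ x) x := fun x =>
    intervalIntegral.integral_hasDerivAt_right (hcont.intervalIntegrable _ _)
      hcont.stronglyMeasurable.stronglyMeasurableAtFilter hcont.continuousAt
  have hder : deriv (fun t => ∫ s in a..t, χ s) = χ := funext fun x => (hd x).deriv
  have hab : a ≤ b := (haa.1.trans haa.2).le
  have hsupp : Function.support (fun t => ∫ s in a..t, χ s) ⊆ Icc a' b' := by
    intro t ht
    by_contra hcon
    apply ht
    simp only [mem_Icc, not_and_or, not_le] at hcon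
    rcases hcon with h | h
    · apply intervalIntegral.integral_zero_ae
      refine Filter.Eventually.of_forall fun x hx => hz x fun hx' => ?_
      rcases mem_uIoc.1 hx with h1 | h1
      · linarith [hx'.1]
      · linarith [hx'.1, haa.1]
    · change ∫ s in a..t, χ s = 0
      have h1 : ∫ s in a..b, χ s = 0 := by
        rw [intervalIntegral.integral_of_le hab, integral_Ioc_eq_integral_Ioo, h0]
      rw [← intervalIntegral.integral_add_adjacent_intervals (hcont.intervalIntegrable a b)
        (hcont.intervalIntegrable b t), h1, zero_add]
      apply intervalIntegral.integral_zero_ae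
      refine Filter.Eventually.of_forall fun x hx => hz x fun hx' => ?_
      rcases mem_uIoc.1 hx with h1 | h1
      · linarith [hx'.2, hbb.2]
      · linarith [hx'.2, hbb.2]
  have hts : tsupport (fun t => ∫ s in a..t, χ s) ⊆ Icc a' b' :=
    closure_minimal hsupp isClosed_Icc
  refine ⟨fun t => ∫ s in a..t, χ s, ?_, ?_, ?_, hder⟩
  · rw [contDiff_infty_iff_deriv]
    exact ⟨fun x => (hd x).differentiableAt, by rw [hder]; exact hχ⟩
  · exact HasCompactSupport.intro isCompact_Icc fun x hx => by
      by_contra h; exact hx (hsupp h)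
  · exact hts.trans fun x hx => ⟨haa.1.trans_le hx.1, hx.2.trans_lt hbb.2⟩

/-- A continuous function with vanishing weak derivative is constant. -/
theorem eqOn_const_of_weakDeriv_zero {a b : ℝ} (hab : a < b) {f : ℝ → ℝ}
    (hf : ContinuousOn f (Icc a b))
    (h : ∀ φ : ℝ → ℝ, ContDiff ℝ ∞ φ → HasCompactSupport φ → tsupport φ ⊆ Ioo a b →
      ∫ t in Ioo a b, f t * deriv φ t = 0) :
    ∃ c, ∀ t ∈ Icc a b, f t = c := by
  have hfi : IntegrableOn f (Ioo a b) := hf.integrableOn_Icc.mono_set Ioo_subset_Icc_self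
  obtain ⟨ψ, hψ, hψK, hψs, hψ1⟩ : ∃ ψ : ℝ → ℝ, ContDiff ℝ ∞ ψ ∧ HasCompactSupport ψ ∧
      tsupport ψ ⊆ Ioo a b ∧ ∫ t in Ioo a b, ψ t = 1 := by
    let B : ContDiffBump ((a + b) / 2) := ⟨(b - a) / 8, (b - a) / 4, by linarith, by linarith⟩
    have hs : tsupport (B.normed volume) ⊆ Ioo a b := by
      rw [B.tsupport_normed_eq, Real.closedBall_eq_Icc]
      intro x hx
      have : B.rOut = (b - a) / 4 := rfl
      rw [this] at hx
      exact ⟨by linarith [hx.1], by linarith [hx.2]⟩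
    refine ⟨B.normed volume, B.contDiff_normed, B.hasCompactSupport_normed, hs, ?_⟩
    rw [setIntegral_eq_integral_of_forall_compl_eq_zero, B.integral_normed]
    intro x hx
    by_contra h
    exact hx (hs (subset_tsupport _ h))
  have hmulint : ∀ χ : ℝ → ℝ, ContDiff ℝ ∞ χ → IntegrableOn (fun t => f t * χ t) (Ioo a b) :=
    fun χ hχ => ((hf.mul hχ.continuous.continuousOn).integrableOn_Icc).mono_set
      Ioo_subset_Icc_self
  have hint : ∀ χ : ℝ → ℝ, ContDiff ℝ ∞ χ → IntegrableOn χ (Ioo a b) :=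
    fun χ hχ => hχ.continuous.continuousOn.integrableOn_Icc.mono_set Ioo_subset_Icc_self
  set c := ∫ t in Ioo a b, f t * ψ t with hc
  refine ⟨c, ?_⟩
  have hae : ∀ᵐ x, x ∈ Ioo a b → f x - c = 0 := by
    refine isOpen_Ioo.ae_eq_zero_of_integral_contDiff_smul_eq_zero
      (hfi.sub (integrableOn_const (by simp))).locallyIntegrableOn ?_
    intro χ hχ hχK hχs
    set I := ∫ t in Ioo a b, χ t with hI
    -- Subtracting `I * ψ` kills the integral, so the difference is the derivative of a test
    -- function; this forces the constant to be `∫ f ψ`.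
    have hχ' : ContDiff ℝ ∞ (fun t => χ t - I * ψ t) := hχ.sub (contDiff_const.mul hψ)
    obtain ⟨φ, h1, h2, h3, h4⟩ := exists_testFunction_deriv_eq (a := a) (b := b) hχ'
      (hχK.sub hψK.mul_left)
      ((tsupport_sub _ _).trans (union_subset hχs ((tsupport_mul_subset_right).trans hψs)))
      (by rw [integral_sub (hint _ hχ) ((hint _ hψ).const_mul _), integral_const_mul, hψ1]
          simp [hI])
    have h5 := h φ h1 h2 h3
    rw [h4] at h5
    have h6 : ∫ t in Ioo a b, f t * χ t = I * c := by
      have : ∫ t in Ioo a b, f t * (χ t - I * ψ t)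
          = (∫ t in Ioo a b, f t * χ t) - I * c := by
        rw [hc, ← integral_const_mul, ← integral_sub (hmulint _ hχ) ((hmulint _ hψ).const_mul _)]
        congr 1; ext t; ring
      linarith
    rw [← setIntegral_eq_integral_of_forall_compl_eq_zero (s := Ioo a b)]
    · have : ∫ t in Ioo a b, χ t • (f t - c)
          = (∫ t in Ioo a b, f t * χ t) - c * I := by
        rw [hI, ← integral_const_mul, ← integral_sub (hmulint _ hχ) ((hint _ hχ).const_mul _)]
        congr 1; ext t; simp only [smul_eq_mul]; ring
      rw [this, h6]; ring
    · intro x hx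
      have : χ x = 0 := by
        by_contra h
        exact hx (hχs (subset_tsupport _ h))
      simp [this]
  have := Measure.eqOn_Icc_of_ae_eq volume hab.ne (f := f) (g := fun _ => c) ?_ hf
    continuousOn_const
  · exact this
  · rw [← restrict_Ioo_eq_restrict_Icc, Filter.EventuallyEq, ae_restrict_iff' measurableSet_Ioo]
    filter_upwards [hae] with x hx hx'
    linarith [hx hx']

/-- A continuous function with an integrable weak derivative is its primitive. -/
theorem eq_add_integral_of_isWeakDeriv {a b : ℝ} (hab : a < b) {f g : ℝ → ℝ}
    (hf : ContinuousOn f (Icc a b)) (hg : IntegrableOn g (Ioo a b)) (h : IsWeakDeriv f g a b) :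
    ∀ t ∈ Icc a b, f t = f a + ∫ s in a..t, g s := by
  have hgi : IntervalIntegrable g volume a b := by
    rwa [intervalIntegrable_iff_integrableOn_Ioo_of_le hab.le]
  have hG : AbsolutelyContinuousOnInterval (fun t => ∫ s in a..t, g s) a b :=
    hgi.absolutelyContinuousOnInterval_intervalIntegral left_mem_uIcc
  have hGc : ContinuousOn (fun t => ∫ s in a..t, g s) (Icc a b) := by
    simpa [uIcc_of_le hab.le] using hG.continuousOn
  -- The primitive of `g` is absolutely continuous, so integration by parts shows that its weak
  -- derivative is `g` too; the difference has weak derivative zero.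
  obtain ⟨c, hc⟩ := eqOn_const_of_weakDeriv_zero hab (hf.sub hGc) (by
    intro φ hφ hφK hφs
    have hφd : Continuous (deriv φ) := (contDiff_infty_iff_deriv.1 hφ).2.continuous
    have hz : ∀ x, x ∉ Ioo a b → φ x = 0 := fun x hx => by
      by_contra h'; exact hx (hφs (subset_tsupport _ h'))
    have h1 := hG.integral_mul_deriv_eq_deriv_mul
      ((hφ.of_le (by simp)).contDiffOn (s := uIcc a b)).absolutelyContinuousOnInterval
    rw [hz b (by simp), hz a (by simp)] at h1
    have h2 : ∫ x in a..b, deriv (fun t => ∫ s in a..t, g s) x * φ x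
        = ∫ x in a..b, g x * φ x := by
      apply intervalIntegral.integral_congr_ae
      filter_upwards [hgi.ae_hasDerivAt_integral] with x hx hx'
      rw [(hx (uIoc_subset_uIcc hx') a left_mem_uIcc).deriv]
    rw [h2] at h1
    have h3 := h φ hφ hφK hφs
    simp only [← integral_Ioc_eq_integral_Ioo, ← intervalIntegral.integral_of_le hab.le] at h3 ⊢
    have h4 : ∫ t in a..b, (f t - ∫ s in a..t, g s) * deriv φ t
        = (∫ t in a..b, f t * deriv φ t) - ∫ t in a..b, (∫ s in a..t, g s) * deriv φ t := by
      rw [← intervalIntegral.integral_sub]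
      · simp only [sub_mul]
      · exact (hf.mul hφd.continuousOn).intervalIntegrable_of_Icc hab.le
      · exact (hGc.mul hφd.continuousOn).intervalIntegrable_of_Icc hab.le
    simp only [Pi.sub_apply]
    rw [h4, h1, h3]; ring)
  intro t ht
  have h1 := hc t ht
  have h2 := hc a (left_mem_Icc.2 hab.le)
  simp at h1 h2
  linarith

/-- Chain rule estimate for powers of a primitive: `||f(t)|^γ - |f(s)|^γ| ≤ ∫ γ |f|^(γ-1) |f'|`. -/
theorem enorm_rpow_le_add_lintegral {a b : ℝ} (hab : a < b) {f g : ℝ → ℝ}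
    (hg : IntegrableOn g (Ioo a b)) (hfg : ∀ t ∈ Icc a b, f t = f a + ∫ s in a..t, g s)
    {γ : ℝ} (hγ : 1 < γ) {s t : ℝ} (hs : s ∈ Icc a b) (ht : t ∈ Icc a b) :
    ‖f t‖ₑ ^ γ ≤ ‖f s‖ₑ ^ γ +
      ∫⁻ x in Ioo a b, ENNReal.ofReal γ * (‖f x‖ₑ ^ (γ - 1) * ‖g x‖ₑ) := by
  have hgi : IntervalIntegrable g volume a b := by
    rwa [intervalIntegrable_iff_integrableOn_Ioo_of_le hab.le]
  set F : ℝ → ℝ := fun t => f a + ∫ s in a..t, g s with hF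
  have hFac : AbsolutelyContinuousOnInterval F a b :=
    ((contDiffOn_const (c := f a)).absolutelyContinuousOnInterval).add
      (hgi.absolutelyContinuousOnInterval_intervalIntegral left_mem_uIcc)
  have hFd : ∀ᵐ x, x ∈ Icc a b → HasDerivAt F (g x) x := by
    filter_upwards [hgi.ae_hasDerivAt_integral] with x hx hx'
    rw [uIcc_of_le hab.le] at hx
    exact (hx hx' a (left_mem_Icc.2 hab.le)).const_add _
  obtain ⟨R, hR⟩ := hFac.exists_bound
  -- As `γ > 1`, `|x| ^ γ` is `C¹`, hence Lipschitz on the bounded range of `F`; a Lipschitz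
  -- function of an absolutely continuous one is absolutely continuous.
  have hpow : AbsolutelyContinuousOnInterval (fun x => |F x| ^ γ) a b := by
    have hC1 : ContDiffOn ℝ 1 (fun x : ℝ => |x| ^ γ) (Icc (-R) R) := by
      have := (contDiff_norm_rpow (E := ℝ) hγ)
      exact this.contDiffOn
    obtain ⟨K, hK⟩ := hC1.exists_lipschitzOnWith (by decide) (convex_Icc _ _) isCompact_Icc
    have hlip : ∀ x ∈ uIcc a b, ∀ y ∈ uIcc a b,
        dist (|F x| ^ γ) (|F y| ^ γ) ≤ K * dist (F x) (F y) := fun x hx y hy =>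
      hK.dist_le_mul _ (abs_le.1 (hR x hx)) _ (abs_le.1 (hR y hy))
    rw [absolutelyContinuousOnInterval_iff] at hFac ⊢
    intro e he
    obtain ⟨δ, hδ, h⟩ := hFac (e / (K + 1)) (by positivity)
    refine ⟨δ, hδ, fun E hE hlt => ?_⟩
    have h1 := h E hE hlt
    have h2 : ∑ i ∈ Finset.range E.1, dist (|F (E.2 i).1| ^ γ) (|F (E.2 i).2| ^ γ)
        ≤ K * ∑ i ∈ Finset.range E.1, dist (F (E.2 i).1) (F (E.2 i).2) := by
      rw [Finset.mul_sum]
      refine Finset.sum_le_sum fun i hi => ?_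
      have := hE.1 i hi
      exact hlip _ this.1 _ this.2
    have hs0 : 0 ≤ ∑ i ∈ Finset.range E.1, dist (F (E.2 i).1) (F (E.2 i).2) :=
      Finset.sum_nonneg fun _ _ => dist_nonneg
    calc _ ≤ _ := h2
      _ ≤ (K + 1) * ∑ i ∈ Finset.range E.1, dist (F (E.2 i).1) (F (E.2 i).2) := by
        gcongr; linarith
      _ < (K + 1) * (e / (K + 1)) := by gcongr
      _ = e := by field_simp
  have hsub : uIcc s t ⊆ uIcc a b := by
    rw [uIcc_of_le hab.le]; exact uIcc_subset_Icc hs ht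
  have hftc := (hpow.mono hsub).integral_deriv_eq_sub
  have hbound : ‖|F t| ^ γ - |F s| ^ γ‖ₑ ≤
      ∫⁻ x in Ioo a b, ENNReal.ofReal γ * (‖f x‖ₑ ^ (γ - 1) * ‖g x‖ₑ) := by
    rw [← hftc]
    calc ‖∫ x in s..t, deriv (fun x => |F x| ^ γ) x‖ₑ
        = ‖∫ x in uIoc s t, deriv (fun x => |F x| ^ γ) x‖ₑ := by
          rw [← ofReal_norm, intervalIntegral.norm_intervalIntegral_eq, ofReal_norm]
      _ ≤ ∫⁻ x in uIoc s t, ‖deriv (fun x => |F x| ^ γ) x‖ₑ := enorm_integral_le_lintegral_enorm _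
      _ ≤ ∫⁻ x in Ioc a b, ‖deriv (fun x => |F x| ^ γ) x‖ₑ := by
          refine lintegral_mono_set ?_
          exact Ioc_subset_Ioc (le_min hs.1 ht.1) (max_le hs.2 ht.2)
      _ = ∫⁻ x in Ioo a b, ‖deriv (fun x => |F x| ^ γ) x‖ₑ := by
          rw [restrict_Ioo_eq_restrict_Ioc]
      _ = _ := by
          apply lintegral_congr_ae
          rw [Filter.EventuallyEq, ae_restrict_iff' measurableSet_Ioo]
          filter_upwards [hFd] with x hx hx'
          have hxI := Ioo_subset_Icc_self hx'
          have hd := (hasDerivAt_abs_rpow (F x) hγ).comp x (hx hxI)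
          have hd' : deriv (fun x => |F x| ^ γ) x = γ * |F x| ^ (γ - 2) * F x * g x := hd.deriv
          have hFx : F x = f x := (hfg x hxI).symm
          rw [hd', hFx, enorm_mul, enorm_mul, enorm_mul, Real.enorm_of_nonneg (by linarith : 0 ≤ γ),
            mul_assoc, mul_assoc]
          congr 1
          rw [← mul_assoc]
          congr 1
          rcases eq_or_ne (f x) 0 with h0 | h0
          · rw [h0]; simp [ENNReal.zero_rpow_of_pos (by linarith : 0 < γ - 1)]
          · have hpos : 0 < |f x| := abs_pos.2 h0
            rw [Real.enorm_of_nonneg (by positivity), Real.enorm_eq_ofReal_abs,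
              ← ENNReal.ofReal_mul (by positivity), ENNReal.ofReal_rpow_of_pos hpos]
            congr 1
            rw [← Real.rpow_add_one hpos.ne']
            congr 1; ring
  have e1 : ∀ x ∈ Icc a b, ‖f x‖ₑ ^ γ = ‖|F x| ^ γ‖ₑ := fun x hx => by
    have hFx : F x = f x := (hfg x hx).symm
    rw [hFx, Real.enorm_of_nonneg (Real.rpow_nonneg (abs_nonneg _) _), Real.enorm_eq_ofReal_abs,
      ENNReal.ofReal_rpow_of_nonneg (abs_nonneg _) (by linarith)]
  rw [e1 t ht, e1 s hs]
  calc ‖|F t| ^ γ‖ₑ = ‖|F s| ^ γ + (|F t| ^ γ - |F s| ^ γ)‖ₑ := by congr 1; ring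
    _ ≤ ‖|F s| ^ γ‖ₑ + ‖|F t| ^ γ - |F s| ^ γ‖ₑ := enorm_add_le _ _
    _ ≤ _ := by gcongr

/-! ### Sobolev inequality on the lattice and on the grid. -/

/-- Gagliardo–Nirenberg–Sobolev inequality on the lattice: a function that is bounded, in each
coordinate direction, by the sum of `F` along the lattice line is controlled by the sum of `F`. -/
theorem tsum_rpow_le_of_le_line_sum {d : ℕ} (hd : 2 ≤ d) {h F : (Fin d → ℤ) → ℝ≥0∞}
    (hF : ∀ k i, h k ≤ ∑' l : ℤ, F (Function.update k i l)) :
    ∑' k, h k ^ ((d : ℝ) / (d - 1)) ≤ (∑' k, F k) ^ ((d : ℝ) / (d - 1)) := by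
  have hd1 : (0 : ℝ) < d - 1 := by
    have : (2 : ℝ) ≤ d := by exact_mod_cast hd
    linarith
  have hpi : ∀ G : (Fin d → ℤ) → ℝ≥0∞,
      ∫⁻ x, G x ∂(Measure.pi fun _ : Fin d => (Measure.count : Measure ℤ)) = ∑' k, G k := by
    intro G
    rw [lintegral_countable']
    simp
  have hconj : Real.HolderConjugate (Fintype.card (Fin d)) ((d : ℝ) / (d - 1)) := by
    rw [Fintype.card_fin]
    exact Real.HolderConjugate.conjExponent (by linarith)
  -- The grid-lines inequality behind the Euclidean Sobolev inequality holds for any product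
  -- measure; here it is applied to counting measure on `ℤ`.
  have := lintegral_prod_lintegral_pow_le (fun _ : Fin d => (Measure.count : Measure ℤ)) hconj
    (f := F) (measurable_of_countable F)
  rw [hpi, hpi] at this
  refine le_trans (ENNReal.tsum_le_tsum fun k => ?_) this
  simp only [lintegral_count, Fintype.card_fin]
  calc h k ^ ((d : ℝ) / (d - 1)) = ∏ _i : Fin d, h k ^ (1 / ((d : ℝ) - 1)) := by
        rw [Finset.prod_const, Finset.card_univ, Fintype.card_fin, ← ENNReal.rpow_natCast,
          ← ENNReal.rpow_mul]
        congr 1; field_simp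
    _ ≤ _ := Finset.prod_le_prod' fun i _ => by gcongr; exact hF k i

variable {d : ℕ} {ε : ℝ}

theorem onEdge_of_mem {u : grid d ε → ℝ} {e : Edge d} {t : ℝ} (ht : t ∈ Icc 0 ε) :
    onEdge u e t = u ⟨edgePoint ε e t, e, t, ht, rfl⟩ := dif_pos ht

theorem edgePoint_continuous (e : Edge d) : Continuous (edgePoint ε e) := by
  unfold edgePoint; fun_prop

theorem onEdge_continuousOn {u : grid d ε → ℝ} (hu : Continuous u) (e : Edge d) :
    ContinuousOn (onEdge u e) (Icc 0 ε) := by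
  rw [continuousOn_iff_continuous_domRestrict]
  have : (Icc 0 ε).domRestrict (onEdge u e) =
      fun t : Icc 0 ε => u ⟨edgePoint ε e t, e, t, t.2, rfl⟩ :=
    funext fun t => onEdge_of_mem t.2
  rw [this]
  exact hu.comp (((edgePoint_continuous e).comp continuous_subtype_val).subtype_mk _)

theorem edgePoint_zero (k : Fin d → ℤ) (i : Fin d) : edgePoint ε (k, i) 0 = vertex ε k := by
  simp [edgePoint]

theorem edgePoint_end (k : Fin d → ℤ) (i : Fin d) :
    edgePoint ε (k, i) ε = vertex ε (Function.update k i (k i + 1)) := by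
  ext j
  rcases eq_or_ne j i with rfl | h
  · simp [edgePoint, vertex]; ring
  · simp [edgePoint, vertex, h]

/-- Edges meeting at a vertex see the same value because `u` lives on a subset of `ℝ^d`. Together
with `onEdge_end_eq` this lets estimates on single edges be chained. -/
theorem onEdge_start_eq (hε : 0 ≤ ε) (u : grid d ε → ℝ) (k : Fin d → ℤ) (i j : Fin d) :
    onEdge u (k, i) 0 = onEdge u (k, j) 0 := by
  rw [onEdge_of_mem ⟨le_rfl, hε⟩, onEdge_of_mem ⟨le_rfl, hε⟩]
  simp only [edgePoint_zero]

theorem onEdge_end_eq (hε : 0 ≤ ε) (u : grid d ε → ℝ) (k : Fin d → ℤ) (i j : Fin d) :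
    onEdge u (k, i) ε = onEdge u (Function.update k i (k i + 1), j) 0 := by
  rw [onEdge_of_mem ⟨hε, le_rfl⟩, onEdge_of_mem ⟨le_rfl, hε⟩]
  simp only [edgePoint_zero, edgePoint_end]

namespace H1

theorem integrableOn_der (u : H1 d ε) (e : Edge d) : IntegrableOn (u.der e) (Ioo 0 ε) := by
  have h1 : ∫⁻ t in Ioo (0 : ℝ) ε, ‖u.der e t‖ₑ ^ (2 : ℝ) < ⊤ :=
    (ENNReal.le_tsum e).trans_lt u.lpPow_der_lt_top
  have h2 : MemLp (u.der e) 2 (volume.restrict (Ioo 0 ε)) :=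
    ⟨u.aestronglyMeasurable_der e, by
      rw [eLpNorm_lt_top_iff_lintegral_rpow_enorm_lt_top (by simp) (by simp)]
      simpa using h1⟩
  exact h2.integrable (by norm_num)

/-- The integral of `|(|u|^γ)'|` over an edge. -/
def powVar (u : H1 d ε) (γ : ℝ) (e : Edge d) : ℝ≥0∞ :=
  ∫⁻ x in Ioo 0 ε, ENNReal.ofReal γ * (‖onEdge u.toFun e x‖ₑ ^ (γ - 1) * ‖u.der e x‖ₑ)

theorem enorm_rpow_onEdge_le (u : H1 d ε) (hε : 0 < ε) {γ : ℝ} (hγ : 1 < γ) (e : Edge d)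
    {s t : ℝ} (hs : s ∈ Icc 0 ε) (ht : t ∈ Icc 0 ε) :
    ‖onEdge u.toFun e t‖ₑ ^ γ ≤ ‖onEdge u.toFun e s‖ₑ ^ γ + u.powVar γ e :=
  enorm_rpow_le_add_lintegral hε (u.integrableOn_der e)
    (eq_add_integral_of_isWeakDeriv hε (onEdge_continuousOn u.continuous_toFun e)
      (u.integrableOn_der e) (u.isWeakDeriv e)) hγ hs ht

/-- The integral of `|(|u|^γ)'|` over the edges starting at a vertex. -/
def vertexVar (u : H1 d ε) (γ : ℝ) (k : Fin d → ℤ) : ℝ≥0∞ := ∑ i, u.powVar γ (k, i)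

theorem powVar_le_vertexVar (u : H1 d ε) (γ : ℝ) (k : Fin d → ℤ) (i : Fin d) :
    u.powVar γ (k, i) ≤ u.vertexVar γ k :=
  Finset.single_le_sum (f := fun i => u.powVar γ (k, i)) (fun _ _ => zero_le) (Finset.mem_univ i)

theorem tsum_vertexVar (u : H1 d ε) (γ : ℝ) : ∑' k, u.vertexVar γ k = ∑' e, u.powVar γ e := by
  rw [ENNReal.tsum_prod']
  simp [vertexVar, tsum_fintype]

/-- Telescoping over `n` consecutive edges of a grid line, each crossed from its far end back to its
start. -/
theorem enorm_rpow_vertex_le_step (u : H1 d ε) (hε : 0 < ε) {γ : ℝ} (hγ : 1 < γ)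
    (k : Fin d → ℤ) (i : Fin d) (n : ℕ) :
    ‖onEdge u.toFun (k, i) 0‖ₑ ^ γ ≤
      ‖onEdge u.toFun (Function.update k i (k i + n), i) 0‖ₑ ^ γ +
        ∑ j ∈ Finset.range n, u.vertexVar γ (Function.update k i (k i + j)) := by
  induction n with
  | zero => simp
  | succ n ih =>
    refine ih.trans ?_
    rw [Finset.sum_range_succ, add_comm (∑ j ∈ Finset.range n, _), ← add_assoc]
    gcongr
    have h1 := u.enorm_rpow_onEdge_le hε hγ (Function.update k i (k i + n), i)
      (s := ε) (t := 0) ⟨hε.le, le_rfl⟩ ⟨le_rfl, hε.le⟩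
    rw [onEdge_end_eq hε.le _ _ i i] at h1
    simp only [Function.update_self, Function.update_idem, add_assoc] at h1
    push_cast
    exact h1.trans (by gcongr; exact u.powVar_le_vertexVar γ _ i)

theorem sum_vertexVar_le_line (u : H1 d ε) (γ : ℝ) (k : Fin d → ℤ) (i : Fin d) (n : ℕ) :
    ∑ j ∈ Finset.range n, u.vertexVar γ (Function.update k i (k i + j)) ≤
      ∑' l : ℤ, u.vertexVar γ (Function.update k i l) := by
  refine (ENNReal.sum_le_tsum (f := fun j : ℕ => u.vertexVar γ (Function.update k i (k i + j)))
    _).trans ?_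
  exact ENNReal.tsum_comp_le_tsum_of_injective (f := fun j : ℕ => k i + (j : ℤ))
    (fun a b h => by simpa using h) (fun l : ℤ => u.vertexVar γ (Function.update k i l))

/-- The value of `|u|^γ` at a vertex is at most its variation along any grid line through it. -/
theorem enorm_rpow_vertex_le_line (u : H1 d ε) (hε : 0 < ε) {γ : ℝ} (hγ : 1 < γ)
    (k : Fin d → ℤ) (i : Fin d) :
    ‖onEdge u.toFun (k, i) 0‖ₑ ^ γ ≤ ∑' l : ℤ, u.vertexVar γ (Function.update k i l) := by
  -- Otherwise `|u| ^ γ` stays above a positive constant `c` on the whole positive ray from the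
  -- vertex: infinitely many edges of length `ε`, contradicting `u ∈ L²`.
  by_contra! hlt
  set G := ∑' l : ℤ, u.vertexVar γ (Function.update k i l) with hG
  set c := ‖onEdge u.toFun (k, i) 0‖ₑ ^ γ - G with hc
  have hc0 : c ≠ 0 := (tsub_pos_of_lt hlt).ne'
  have key : ∀ n : ℕ, ∀ s ∈ Icc 0 ε,
      c ≤ ‖onEdge u.toFun (Function.update k i (k i + n), i) s‖ₑ ^ γ := by
    intro n s hs
    rw [hc, tsub_le_iff_right]
    have h1 := u.enorm_rpow_vertex_le_step hε hγ k i n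
    have h2 := u.enorm_rpow_onEdge_le hε hγ (Function.update k i (k i + n), i)
      (s := s) (t := 0) hs ⟨le_rfl, hε.le⟩
    calc _ ≤ _ := h1
      _ ≤ ‖onEdge u.toFun (Function.update k i (k i + n), i) s‖ₑ ^ γ +
          u.vertexVar γ (Function.update k i (k i + n)) +
          ∑ j ∈ Finset.range n, u.vertexVar γ (Function.update k i (k i + j)) := by
        gcongr
        exact h2.trans (by gcongr; exact u.powVar_le_vertexVar γ _ i)
      _ ≤ _ := by
        rw [add_assoc, add_comm (u.vertexVar γ _), ← Finset.sum_range_succ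
          (fun j : ℕ => u.vertexVar γ (Function.update k i (k i + j)))]
        gcongr
        exact u.sum_vertexVar_le_line γ k i (n + 1)
  have hint : ∀ n : ℕ, c ^ (2 / γ) * ENNReal.ofReal ε ≤ ∫⁻ t in Ioo (0 : ℝ) ε,
      ‖onEdge u.toFun (Function.update k i (k i + n), i) t‖ₑ ^ (2 : ℝ) := by
    intro n
    calc c ^ (2 / γ) * ENNReal.ofReal ε = ∫⁻ _ in Ioo (0 : ℝ) ε, c ^ (2 / γ) := by simp
      _ ≤ _ := by
        refine setLIntegral_mono' measurableSet_Ioo fun t ht => ?_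
        calc c ^ (2 / γ) ≤
            (‖onEdge u.toFun (Function.update k i (k i + n), i) t‖ₑ ^ γ) ^ (2 / γ) := by
              have : 0 < γ := by linarith
              exact ENNReal.rpow_le_rpow (key n t (Ioo_subset_Icc_self ht)) (by positivity)
          _ = _ := by
            rw [← ENNReal.rpow_mul]; congr 1; field_simp
  have hsum : ∑' n : ℕ, ∫⁻ t in Ioo (0 : ℝ) ε,
      ‖onEdge u.toFun (Function.update k i (k i + n), i) t‖ₑ ^ (2 : ℝ) ≤
        lpPow ε 2 (onEdge u.toFun) :=
    ENNReal.tsum_comp_le_tsum_of_injective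
      (f := fun n : ℕ => ((Function.update k i (k i + (n : ℤ)), i) : Edge d))
      (fun a b h => by
        have := congrFun (congrArg Prod.fst h) i
        simpa using this) (fun e => ∫⁻ t in Ioo (0 : ℝ) ε, ‖onEdge u.toFun e t‖ₑ ^ (2 : ℝ))
  have htop : ∑' _ : ℕ, c ^ (2 / γ) * ENNReal.ofReal ε = ⊤ := by
    apply ENNReal.tsum_const_eq_top_of_ne_zero
    refine mul_ne_zero ?_ (by simpa using hε)
    have : 0 < 2 / γ := by have : 0 < γ := by linarith
                           positivity
    simp [ENNReal.rpow_eq_zero_iff, hc0, this.not_gt]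
  have := (ENNReal.tsum_le_tsum hint).trans hsum
  rw [htop, top_le_iff] at this
  exact u.lpPow_toFun_lt_top.ne this

theorem vertexVar_le_line (u : H1 d ε) (γ : ℝ) (k : Fin d → ℤ) (i : Fin d) :
    u.vertexVar γ k ≤ ∑' l : ℤ, u.vertexVar γ (Function.update k i l) := by
  have := ENNReal.le_tsum (f := fun l : ℤ => u.vertexVar γ (Function.update k i l)) (k i)
  simpa using this

/-- On the edges starting at a vertex, `|u|^γ` is bounded by twice its variation along any grid
line through that vertex. -/
theorem enorm_rpow_le_line (u : H1 d ε) (hε : 0 < ε) {γ : ℝ} (hγ : 1 < γ)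
    (k : Fin d → ℤ) (i j : Fin d) {t : ℝ} (ht : t ∈ Icc 0 ε) :
    ‖onEdge u.toFun (k, j) t‖ₑ ^ γ ≤
      ∑' l : ℤ, 2 * u.vertexVar γ (Function.update k i l) := by
  -- One copy of the line variation pays for the value at the vertex, the other for the edge leaving
  -- it.
  rw [ENNReal.tsum_mul_left, two_mul]
  refine (u.enorm_rpow_onEdge_le hε hγ (k, j) (s := 0) ⟨le_rfl, hε.le⟩ ht).trans ?_
  rw [onEdge_start_eq hε.le _ k j i]
  gcongr
  · exact u.enorm_rpow_vertex_le_line hε hγ k i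
  · exact (u.powVar_le_vertexVar γ k j).trans (u.vertexVar_le_line γ k i)

theorem enorm_rpow_le_tsum_powVar (u : H1 d ε) (hε : 0 < ε) {γ : ℝ} (hγ : 1 < γ)
    (e : Edge d) {t : ℝ} (ht : t ∈ Icc 0 ε) :
    ‖onEdge u.toFun e t‖ₑ ^ γ ≤ 2 * ∑' e, u.powVar γ e := by
  obtain ⟨k, j⟩ := e
  refine (u.enorm_rpow_le_line hε hγ k j j ht).trans ?_
  rw [ENNReal.tsum_mul_left, ← u.tsum_vertexVar]
  gcongr
  exact ENNReal.tsum_comp_le_tsum_of_injective (f := fun l : ℤ => Function.update k j l)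
    (Function.update_injective k j) _

/-- Sobolev inequality for `|u|^γ` on the grid. -/
theorem lpPow_mul_le_tsum_powVar (u : H1 d ε) (hd : 2 ≤ d) (hε : 0 < ε) {γ : ℝ} (hγ : 1 < γ) :
    lpPow ε (γ * ((d : ℝ) / (d - 1))) (onEdge u.toFun) ≤
      d * ENNReal.ofReal ε * (2 * ∑' e, u.powVar γ e) ^ ((d : ℝ) / (d - 1)) := by
  have hd1 : (0 : ℝ) < d - 1 := by
    have : (2 : ℝ) ≤ d := by exact_mod_cast hd
    linarith
  -- Taking the supremum over the edges leaving `k` reduces the claim to a function on `ℤ^d`; the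
  -- factor `d * ε` is the total length of these edges.
  set h : (Fin d → ℤ) → ℝ≥0∞ := fun k => ⨆ j : Fin d, ⨆ t ∈ Icc (0 : ℝ) ε,
    ‖onEdge u.toFun (k, j) t‖ₑ ^ γ with hh
  have hle := tsum_rpow_le_of_le_line_sum hd (h := h) (F := fun k => 2 * u.vertexVar γ k)
    fun k i => iSup_le fun j => iSup₂_le fun t ht => u.enorm_rpow_le_line hε hγ k i j ht
  rw [ENNReal.tsum_mul_left, u.tsum_vertexVar] at hle
  calc lpPow ε (γ * ((d : ℝ) / (d - 1))) (onEdge u.toFun)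
      ≤ ∑' e : Edge d, h e.1 ^ ((d : ℝ) / (d - 1)) * ENNReal.ofReal ε := by
        refine ENNReal.tsum_le_tsum fun e => ?_
        calc _ ≤ ∫⁻ _ in Ioo (0 : ℝ) ε, h e.1 ^ ((d : ℝ) / (d - 1)) := by
              refine setLIntegral_mono' measurableSet_Ioo fun t ht => ?_
              rw [ENNReal.rpow_mul]
              gcongr
              exact le_iSup_of_le e.2 (le_iSup₂_of_le t (Ioo_subset_Icc_self ht) le_rfl)
          _ = _ := by simp
    _ = d * ENNReal.ofReal ε * ∑' k, h k ^ ((d : ℝ) / (d - 1)) := by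
        rw [ENNReal.tsum_prod', ENNReal.tsum_mul_left.symm]
        refine tsum_congr fun k => ?_
        simp [tsum_fintype]; ring
    _ ≤ _ := by gcongr

end H1

/-! ### Hölder, interpolation and the critical Gagliardo–Nirenberg inequality. -/

theorem tsum_mul_rpow_le {α : Type*} (f g : α → ℝ≥0∞) {a b : ℝ} (ha : 0 ≤ a) (hb : 0 ≤ b)
    (hab : a + b = 1) : ∑' x, f x ^ a * g x ^ b ≤ (∑' x, f x) ^ a * (∑' x, g x) ^ b := by
  let _ : MeasurableSpace α := ⊤
  simpa only [lintegral_count] using ENNReal.lintegral_mul_norm_pow_le (μ := Measure.count)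
    (measurable_from_top (f := f)).aemeasurable (measurable_from_top (f := g)).aemeasurable
    ha hb hab

/-- Hölder's inequality on the grid. -/
theorem tsum_lintegral_mul_rpow_le {f g : Edge d → ℝ → ℝ≥0∞}
    (hf : ∀ e, AEMeasurable (f e) (volume.restrict (Ioo 0 ε)))
    (hg : ∀ e, AEMeasurable (g e) (volume.restrict (Ioo 0 ε)))
    {a b : ℝ} (ha : 0 ≤ a) (hb : 0 ≤ b) (hab : a + b = 1) :
    ∑' e, ∫⁻ t in Ioo 0 ε, f e t ^ a * g e t ^ b ≤
      (∑' e, ∫⁻ t in Ioo 0 ε, f e t) ^ a * (∑' e, ∫⁻ t in Ioo 0 ε, g e t) ^ b :=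
  (ENNReal.tsum_le_tsum fun e =>
    ENNReal.lintegral_mul_norm_pow_le (hf e) (hg e) ha hb hab).trans
    (tsum_mul_rpow_le _ _ ha hb hab)

namespace H1

theorem aemeasurable_onEdge (u : H1 d ε) (e : Edge d) :
    AEMeasurable (onEdge u.toFun e) (volume.restrict (Ioo 0 ε)) :=
  ((onEdge_continuousOn u.continuous_toFun e).mono Ioo_subset_Icc_self).aemeasurable
    measurableSet_Ioo

/-- Interpolation between Lebesgue norms on the grid. -/
theorem lpPow_interpolate (u : H1 d ε) {q₀ q₁ θ : ℝ} (h₀ : 0 ≤ q₀) (h₁ : 0 ≤ q₁) (hθ : 0 ≤ θ)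
    (hθ' : θ ≤ 1) :
    lpPow ε (q₀ * (1 - θ) + q₁ * θ) (onEdge u.toFun) ≤
      lpPow ε q₀ (onEdge u.toFun) ^ (1 - θ) * lpPow ε q₁ (onEdge u.toFun) ^ θ := by
  refine le_trans (le_of_eq ?_) (tsum_lintegral_mul_rpow_le
    (fun e => (u.aemeasurable_onEdge e).enorm.pow_const q₀)
    (fun e => (u.aemeasurable_onEdge e).enorm.pow_const q₁) (by linarith) hθ (by ring))
  refine tsum_congr fun e => lintegral_congr fun t => ?_
  rw [← ENNReal.rpow_mul, ← ENNReal.rpow_mul, ENNReal.rpow_add_of_nonneg _ _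
    (mul_nonneg h₀ (by linarith)) (mul_nonneg h₁ hθ)]

/-- Cauchy–Schwarz applied to `|u| ^ (γ - 1) * |u'|`. -/
theorem tsum_powVar_le (u : H1 d ε) (γ : ℝ) :
    ∑' e, u.powVar γ e ≤ ENNReal.ofReal γ *
      (lpPow ε (2 * γ - 2) (onEdge u.toFun) ^ (1 / 2 : ℝ) * lpPow ε 2 u.der ^ (1 / 2 : ℝ)) := by
  have hmeas : ∀ e, AEMeasurable (u.der e) (volume.restrict (Ioo 0 ε)) :=
    fun e => (u.aestronglyMeasurable_der e).aemeasurable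
  have h1 : ∀ e, u.powVar γ e = ENNReal.ofReal γ *
      ∫⁻ t in Ioo 0 ε, (‖onEdge u.toFun e t‖ₑ ^ (2 * γ - 2)) ^ (1 / 2 : ℝ) *
        (‖u.der e t‖ₑ ^ (2 : ℝ)) ^ (1 / 2 : ℝ) := by
    intro e
    rw [powVar, lintegral_const_mul' _ _ ENNReal.ofReal_ne_top]
    congr 1
    refine lintegral_congr fun t => ?_
    rw [← ENNReal.rpow_mul, ← ENNReal.rpow_mul]
    congr 1
    · congr 1; ring
    · norm_num
  simp_rw [h1]
  rw [ENNReal.tsum_mul_left]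
  gcongr
  exact tsum_lintegral_mul_rpow_le (fun e => (u.aemeasurable_onEdge e).enorm.pow_const _)
    (fun e => (hmeas e).enorm.pow_const _) (by norm_num) (by norm_num) (by norm_num)

/-- With `γ = 2` the exponent `2γ - 2` is again `2`, so the `L²` norms of `u` and `u'` already bound
`|u|²` uniformly; the remaining power of `|u|` is integrated as `|u|²`. -/
theorem lpPow_ne_top (u : H1 d ε) (hε : 0 < ε) {q : ℝ} (hq : 2 ≤ q) :
    lpPow ε q (onEdge u.toFun) ≠ ⊤ := by
  have h2 := u.tsum_powVar_le 2
  set B := 2 * ∑' e, u.powVar 2 e with hB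
  have hBt : B ≠ ⊤ := by
    refine ENNReal.mul_ne_top (by simp) (ne_top_of_le_ne_top ?_ h2)
    refine ENNReal.mul_ne_top (by simp) (ENNReal.mul_ne_top ?_ ?_)
    · refine ENNReal.rpow_ne_top_of_nonneg (by norm_num) ?_
      norm_num
      exact u.lpPow_toFun_lt_top.ne
    · exact ENNReal.rpow_ne_top_of_nonneg (by norm_num) u.lpPow_der_lt_top.ne
  have hle : lpPow ε q (onEdge u.toFun) ≤
      B ^ ((q - 2) / 2) * lpPow ε 2 (onEdge u.toFun) := by
    have hBq : B ^ ((q - 2) / 2) ≠ ⊤ := ENNReal.rpow_ne_top_of_nonneg (by linarith) hBt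
    rw [lpPow, lpPow, ← ENNReal.tsum_mul_left]
    refine ENNReal.tsum_le_tsum fun e => ?_
    rw [← lintegral_const_mul' _ _ hBq]
    refine setLIntegral_mono' measurableSet_Ioo fun t ht => ?_
    have h3 := u.enorm_rpow_le_tsum_powVar hε (γ := 2) (by norm_num) e (Ioo_subset_Icc_self ht)
    calc ‖onEdge u.toFun e t‖ₑ ^ q
        = (‖onEdge u.toFun e t‖ₑ ^ (2 : ℝ)) ^ ((q - 2) / 2) *
            ‖onEdge u.toFun e t‖ₑ ^ (2 : ℝ) := by
          rw [← ENNReal.rpow_mul, ← ENNReal.rpow_add_of_nonneg _ _ (by linarith) (by norm_num)]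
          congr 1; ring
      _ ≤ _ := by
          gcongr
  exact ne_top_of_le_ne_top (ENNReal.mul_ne_top
    (ENNReal.rpow_ne_top_of_nonneg (by linarith) hBt) u.lpPow_toFun_lt_top.ne) hle

/-- The `d`-dimensional Gagliardo–Nirenberg inequality on the grid at the mass-critical exponent
`2 + 4 / d`. -/
theorem lpPow_critical_le (u : H1 d ε) (hd : 2 ≤ d) (hε : 0 < ε) :
    lpPow ε (2 + 4 / (d : ℝ)) (onEdge u.toFun) ≤
      (d * ENNReal.ofReal ε) ^ (2 - 2 / (d : ℝ)) *
        ENNReal.ofReal (4 * (d + 2) * (d - 1) / (d : ℝ) ^ 2) ^ (2 : ℝ) *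
        (lpPow ε 2 (onEdge u.toFun) ^ (2 / (d : ℝ)) * lpPow ε 2 u.der) := by
  have hd2 : (2 : ℝ) ≤ d := by exact_mod_cast hd
  have hd1 : (0 : ℝ) < d - 1 := by linarith
  have hd0 : (0 : ℝ) < d := by linarith
  -- Chosen so that the Sobolev exponent `γ d / (d - 1)` is `2 + 4/d`; then `2γ - 2` lies between
  -- `2` and `2 + 4/d`, with weight `1 - 2/d` on the latter.
  set γ : ℝ := 2 * (d + 2) * (d - 1) / (d : ℝ) ^ 2 with hγdef
  have hγ : 1 < γ := by
    rw [hγdef, one_lt_div (by positivity)]; nlinarith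
  have hγd : γ * ((d : ℝ) / (d - 1)) = 2 + 4 / (d : ℝ) := by
    rw [hγdef]; field_simp; ring
  have hr : 2 * γ - 2 = 2 * (1 - (1 - 2 / (d : ℝ))) + (2 + 4 / (d : ℝ)) * (1 - 2 / (d : ℝ)) := by
    rw [hγdef]; field_simp; ring
  have hdiv : 2 / (d : ℝ) ≤ 1 := by rw [div_le_one hd0]; exact hd2
  have hdivp : 0 < 2 / (d : ℝ) := by positivity
  set X := lpPow ε (2 + 4 / (d : ℝ)) (onEdge u.toFun) with hX
  set m := lpPow ε 2 (onEdge u.toFun) with hm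
  set D := lpPow ε 2 u.der with hD
  have h1 := u.lpPow_mul_le_tsum_powVar hd hε hγ
  rw [hγd, ← hX] at h1
  have h2 := u.tsum_powVar_le γ
  have h3 := u.lpPow_interpolate (q₀ := 2) (q₁ := 2 + 4 / (d : ℝ)) (θ := 1 - 2 / (d : ℝ))
    (by norm_num) (by positivity) (by linarith) (by linarith)
  rw [← hr, ← hX, ← hm, sub_sub_cancel] at h3
  have hXt : X ≠ ⊤ := u.lpPow_ne_top hε (by linarith [div_nonneg zero_le_four hd0.le])
  have hs : 0 < 2 - 2 / (d : ℝ) := by linarith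
  have hds : (d : ℝ) / (d - 1) * (2 - 2 / (d : ℝ)) = 2 := by field_simp
  have h2γ : ENNReal.ofReal (4 * (d + 2) * (d - 1) / (d : ℝ) ^ 2) = 2 * ENNReal.ofReal γ := by
    rw [← ENNReal.ofReal_ofNat 2, ← ENNReal.ofReal_mul (by norm_num)]
    congr 1; rw [hγdef]; ring
  -- Raising the Sobolev bound to the power `2 - 2/d` makes `D` appear linearly and leaves `X ^ (1 -
  -- 2/d)` on the right, to be absorbed. Absorption needs `X` finite and nonzero.
  have h4 : X * X ^ (1 - 2 / (d : ℝ)) ≤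
      (d * ENNReal.ofReal ε) ^ (2 - 2 / (d : ℝ)) * (2 * ENNReal.ofReal γ) ^ (2 : ℝ) *
        (m ^ (2 / (d : ℝ)) * D) * X ^ (1 - 2 / (d : ℝ)) := by
    calc X * X ^ (1 - 2 / (d : ℝ)) = X ^ (2 - 2 / (d : ℝ)) := by
          nth_rw 1 [← ENNReal.rpow_one X]
          rw [← ENNReal.rpow_add_of_nonneg _ _ (by norm_num) (by linarith)]
          congr 1; ring
      _ ≤ (d * ENNReal.ofReal ε * (2 * (ENNReal.ofReal γ * ((m ^ (2 / (d : ℝ)) *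
          X ^ (1 - 2 / (d : ℝ))) ^ (1 / 2 : ℝ) * D ^ (1 / 2 : ℝ)))) ^ ((d : ℝ) / (d - 1)))
            ^ (2 - 2 / (d : ℝ)) := by
          refine ENNReal.rpow_le_rpow (h1.trans ?_) hs.le
          have : 0 ≤ (d : ℝ) / (d - 1) := by positivity
          gcongr
          refine h2.trans ?_
          gcongr
      _ = _ := by
          rw [ENNReal.mul_rpow_of_nonneg _ _ hs.le, ← ENNReal.rpow_mul, hds,
            ← mul_assoc 2 (ENNReal.ofReal γ), ENNReal.mul_rpow_of_nonneg _ _ zero_le_two,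
            ENNReal.mul_rpow_of_nonneg (_ ^ _) _ zero_le_two, ← ENNReal.rpow_mul,
            ← ENNReal.rpow_mul]
          norm_num
          ring
  rw [h2γ]
  rcases eq_or_ne X 0 with h0 | h0
  · rw [h0]; exact zero_le
  · refine (ENNReal.mul_le_mul_iff_left ?_ ?_).1 h4
    · simp [ENNReal.rpow_eq_zero_iff, h0, hXt]
    · exact ENNReal.rpow_ne_top_of_nonneg (by linarith) hXt

end H1

/-! ### Bump functions as competitors. -/

theorem isWeakDeriv_of_hasDerivAt {a b : ℝ} (hab : a ≤ b) {f F g : ℝ → ℝ}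
    (hfF : ∀ t ∈ Ioo a b, f t = F t) (hF : ∀ t, HasDerivAt F (g t) t) (hg : Continuous g) :
    IsWeakDeriv f g a b := by
  intro φ hφ _ hs
  have hφd : Continuous (deriv φ) := (contDiff_infty_iff_deriv.1 hφ).2.continuous
  have hz : ∀ x, x ∉ Ioo a b → φ x = 0 := fun x hx => by
    by_contra h; exact hx (hs (subset_tsupport _ h))
  have h1 := intervalIntegral.integral_mul_deriv_eq_deriv_mul (a := a) (b := b)
    (fun x _ => hF x) (fun x _ => ((contDiff_infty_iff_deriv.1 hφ).1 x).hasDerivAt)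
    (hg.intervalIntegrable a b) (hφd.intervalIntegrable a b)
  rw [hz a (by simp), hz b (by simp)] at h1
  simp only [intervalIntegral.integral_of_le hab, integral_Ioc_eq_integral_Ioo] at h1
  rw [setIntegral_congr_fun measurableSet_Ioo
    (fun t ht => by simp only [hfF t ht] : EqOn (fun t => f t * deriv φ t)
      (fun t => F t * deriv φ t) (Ioo a b)), h1]
  ring

/-- The square makes the truncated profile `C¹`, so the bump has a classical continuous derivative
along every edge. The proof uses `max 0 s ^ 2 = (s * s + s * |s|) / 2`. -/
theorem hasDerivAt_max_zero_sq (s : ℝ) :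
    HasDerivAt (fun s : ℝ => max 0 s ^ 2) (2 * max 0 s) s := by
  have h0 : HasDerivAt (fun s : ℝ => s * |s|) (2 * |s|) s := by
    rcases lt_trichotomy s 0 with h | h | h
    · have : HasDerivAt (fun s : ℝ => s * (-s)) (2 * (-s)) s := by
        convert! (hasDerivAt_id s).mul (hasDerivAt_id s).neg using 1; simp; ring
      rw [abs_of_neg h]
      refine this.congr_of_eventuallyEq ?_
      filter_upwards [Iio_mem_nhds h] with x hx
      rw [abs_of_neg hx]
    · subst h
      rw [abs_zero, mul_zero, hasDerivAt_iff_tendsto_slope_zero]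
      have : Filter.Tendsto (fun t : ℝ => |t|) (nhdsWithin 0 {0}ᶜ) (nhds 0) := by
        have := (continuous_abs (G := ℝ)).tendsto 0
        rw [abs_zero] at this
        exact this.mono_left nhdsWithin_le_nhds
      refine this.congr' ?_
      filter_upwards [self_mem_nhdsWithin] with t ht
      have : t ≠ 0 := ht
      simp [this]
    · have : HasDerivAt (fun s : ℝ => s * s) (2 * s) s := by
        convert! (hasDerivAt_id s).mul (hasDerivAt_id s) using 1; simp; ring
      rw [abs_of_pos h]
      refine this.congr_of_eventuallyEq ?_
      filter_upwards [Ioi_mem_nhds h] with x hx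
      rw [abs_of_pos hx]
  have h1 := (((hasDerivAt_id s).mul (hasDerivAt_id s)).add h0).div_const 2
  have e1 : (fun s : ℝ => max 0 s ^ 2) = fun s => (s * s + s * |s|) / 2 := by
    ext x
    rcases le_total 0 x with h | h
    · rw [max_eq_right h, abs_of_nonneg h]; ring
    · rw [max_eq_left h, abs_of_nonpos h]; ring
  rw [e1]
  convert! h1 using 1
  rcases le_total 0 s with h | h
  · rw [max_eq_right h, abs_of_nonneg h]; simp; ring
  · rw [max_eq_left h, abs_of_nonpos h]; simp; ring

theorem edgePoint_apply (e : Edge d) (t : ℝ) (j : Fin d) :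
    edgePoint ε e t j = ε * e.1 j + if j = e.2 then t else 0 := by
  by_cases h : j = e.2 <;> simp [edgePoint, vertex, h]

/-- The squared norm is polynomial along an edge, so a bump built from it avoids the singularity of
the norm at the origin. -/
theorem norm_edgePoint_sq (e : Edge d) (t : ℝ) :
    ‖edgePoint ε e t‖ ^ 2 = ‖vertex ε e.1‖ ^ 2 + 2 * (t * (ε * e.1 e.2)) + t ^ 2 := by
  rw [edgePoint, norm_add_sq_real, inner_smul_right, norm_smul]
  simp [vertex, EuclideanSpace.inner_single_right]

theorem abs_apply_le_norm (x : EuclideanSpace ℝ (Fin d)) (j : Fin d) : |x j| ≤ ‖x‖ :=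
  PiLp.norm_apply_le x j

/-- The edges starting at a vertex of the box `[-n, n)^d`. -/
def box (d : ℕ) (a b : ℤ) : Finset (Edge d) :=
  (Fintype.piFinset fun _ => Finset.Ico a b) ×ˢ Finset.univ

theorem mem_box {a b : ℤ} {e : Edge d} : e ∈ box d a b ↔ ∀ j, a ≤ e.1 j ∧ e.1 j < b := by
  simp [box]

theorem card_box (a b : ℤ) : (box d a b).card = (b - a).toNat ^ d * d := by
  simp [box]

theorem tsum_lintegral_le_of_box {f : Edge d → ℝ → ℝ≥0∞} {a b : ℤ} {c : ℝ≥0∞}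
    (hle : ∀ e, ∀ t ∈ Ioo 0 ε, f e t ≤ c) (h0 : ∀ e ∉ box d a b, ∀ t ∈ Ioo 0 ε, f e t = 0) :
    ∑' e, ∫⁻ t in Ioo 0 ε, f e t ≤ (box d a b).card * (c * ENNReal.ofReal ε) := by
  rw [tsum_eq_sum (s := box d a b)]
  · rw [← nsmul_eq_mul]
    refine Finset.sum_le_card_nsmul _ _ _ fun e _ => ?_
    calc _ ≤ ∫⁻ _ in Ioo (0 : ℝ) ε, c := setLIntegral_mono' measurableSet_Ioo (hle e)
      _ = _ := by simp
  · intro e he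
    rw [setLIntegral_congr_fun measurableSet_Ioo (h0 e he)]
    simp

theorem le_tsum_lintegral_of_box {f : Edge d → ℝ → ℝ≥0∞} {a b : ℤ} {c : ℝ≥0∞}
    (hle : ∀ e ∈ box d a b, ∀ t ∈ Ioo 0 ε, c ≤ f e t) :
    (box d a b).card * (c * ENNReal.ofReal ε) ≤ ∑' e, ∫⁻ t in Ioo 0 ε, f e t := by
  refine le_trans ?_ (ENNReal.sum_le_tsum (box d a b))
  rw [← nsmul_eq_mul]
  refine Finset.card_nsmul_le_sum _ _ _ fun e he => ?_
  calc c * ENNReal.ofReal ε = ∫⁻ _ in Ioo (0 : ℝ) ε, c := by simp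
    _ ≤ _ := setLIntegral_mono' measurableSet_Ioo (hle e he)

/-- A radial bump function of radius `R` and height `h`. -/
def bump (R h : ℝ) (x : EuclideanSpace ℝ (Fin d)) : ℝ := h * max 0 (1 - ‖x‖ ^ 2 / R ^ 2) ^ 2

theorem bump_continuous (R h : ℝ) : Continuous (bump (d := d) R h) := by
  unfold bump; fun_prop

/-- The derivative of the bump function along the edges of the grid. -/
def bumpDer (ε R h : ℝ) (e : Edge d) (t : ℝ) : ℝ :=
  h * (2 * max 0 (1 - ‖edgePoint ε e t‖ ^ 2 / R ^ 2) * -(2 * edgePoint ε e t e.2 / R ^ 2))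

theorem bumpDer_continuous (R h : ℝ) (e : Edge d) : Continuous (bumpDer ε R h e) := by
  unfold bumpDer edgePoint; fun_prop

theorem hasDerivAt_bump (R h : ℝ) (e : Edge d) (t : ℝ) :
    HasDerivAt (fun t => bump R h (edgePoint ε e t)) (bumpDer ε R h e t) t := by
  have hq : HasDerivAt (fun t => 1 - ‖edgePoint ε e t‖ ^ 2 / R ^ 2)
      (-(2 * edgePoint ε e t e.2 / R ^ 2)) t := by
    simp_rw [norm_edgePoint_sq]
    have h1 := (((((hasDerivAt_id t).mul_const (ε * (e.1 e.2 : ℝ))).const_mul 2).const_add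
      (‖vertex ε e.1‖ ^ 2)).add ((hasDerivAt_id t).pow 2)).div_const (R ^ 2)
    convert! h1.const_sub 1 using 1
    rw [edgePoint_apply]
    simp; ring
  exact ((hasDerivAt_max_zero_sq _).comp t hq).const_mul h

theorem bump_nonneg {R h : ℝ} (hh : 0 ≤ h) (x : EuclideanSpace ℝ (Fin d)) : 0 ≤ bump R h x := by
  unfold bump; positivity

theorem bump_le {R h : ℝ} (hh : 0 ≤ h) (x : EuclideanSpace ℝ (Fin d)) : bump R h x ≤ h := by
  have h1 : max 0 (1 - ‖x‖ ^ 2 / R ^ 2) ≤ 1 := max_le zero_le_one (by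
    have : 0 ≤ ‖x‖ ^ 2 / R ^ 2 := by positivity
    linarith)
  exact mul_le_of_le_one_right hh (pow_le_one₀ (le_max_left _ _) h1)

theorem half_le_bump {R h : ℝ} (hR : 0 < R) (hh : 0 ≤ h) {x : EuclideanSpace ℝ (Fin d)}
    (hx : ‖x‖ ^ 2 ≤ R ^ 2 / 4) : h / 2 ≤ bump R h x := by
  have h1 : ‖x‖ ^ 2 / R ^ 2 ≤ 1 / 4 := by rw [div_le_iff₀ (by positivity)]; linarith
  -- Half the height suffices because `(3/4)² = 9/16 ≥ 1/2`.
  have h2 : (3 / 4 : ℝ) ≤ max 0 (1 - ‖x‖ ^ 2 / R ^ 2) := le_max_of_le_right (by linarith)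
  have h3 : (3 / 4 : ℝ) ^ 2 ≤ max 0 (1 - ‖x‖ ^ 2 / R ^ 2) ^ 2 := by gcongr
  calc h / 2 ≤ h * (3 / 4 : ℝ) ^ 2 := by nlinarith
    _ ≤ _ := by unfold bump; gcongr

theorem max_zero_eq_zero_of_le_norm {R : ℝ} (hR : 0 < R) {x : EuclideanSpace ℝ (Fin d)}
    (hx : R ≤ ‖x‖) : max 0 (1 - ‖x‖ ^ 2 / R ^ 2) = 0 := by
  apply max_eq_left
  have : 1 ≤ ‖x‖ ^ 2 / R ^ 2 := by rw [one_le_div (by positivity)]; gcongr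
  linarith

theorem abs_bumpDer_le {R h : ℝ} (hR : 0 < R) (hh : 0 ≤ h) (e : Edge d) (t : ℝ) :
    |bumpDer ε R h e t| ≤ 4 * h / R := by
  rcases le_or_gt R ‖edgePoint ε e t‖ with hx | hx
  · rw [bumpDer, max_zero_eq_zero_of_le_norm hR hx]
    simp; positivity
  · have h1 : max 0 (1 - ‖edgePoint ε e t‖ ^ 2 / R ^ 2) ≤ 1 := max_le zero_le_one (by
      have : 0 ≤ ‖edgePoint ε e t‖ ^ 2 / R ^ 2 := by positivity
      linarith)
    have h2 : |edgePoint ε e t e.2| ≤ R := (abs_apply_le_norm _ _).trans hx.le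
    rw [bumpDer, abs_mul, abs_mul, abs_neg, abs_div, abs_mul, abs_mul, abs_of_nonneg hh,
      abs_two, abs_of_nonneg (le_max_left _ _), abs_of_nonneg (sq_nonneg R)]
    calc _ ≤ h * (2 * 1 * (2 * R / R ^ 2)) := by gcongr
      _ = _ := by field_simp; ring

/-- The grid points on edges outside the box `[-n, n)^d` have norm at least `n ε`. -/
theorem le_norm_edgePoint (hε : 0 < ε) {n : ℤ} {e : Edge d} (he : e ∉ box d (-n) n) {t : ℝ}
    (ht : t ∈ Ioo 0 ε) : n * ε ≤ ‖edgePoint ε e t‖ := by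
  rw [mem_box] at he
  push Not at he
  obtain ⟨j, hj⟩ := he
  refine le_trans ?_ (abs_apply_le_norm _ j)
  rw [edgePoint_apply]
  have h0 : (0 : ℝ) ≤ if j = e.2 then t else 0 := by split_ifs <;> linarith [ht.1]
  have h1 : (if j = e.2 then t else 0) ≤ ε := by split_ifs <;> linarith [ht.2]
  by_cases h : -n ≤ e.1 j
  · have : (n : ℝ) ≤ e.1 j := by exact_mod_cast hj h
    refine le_trans ?_ (le_abs_self _)
    nlinarith
  -- An edge may move towards the origin by up to `ε`; starting at `-n - 1` or below, it still stays
  -- at distance `n ε`.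
  · have : (e.1 j : ℝ) + 1 ≤ -n := by exact_mod_cast (by omega : e.1 j + 1 ≤ -n)
    refine le_trans ?_ (neg_le_abs _)
    nlinarith

theorem norm_edgePoint_sq_le (hε : 0 < ε) {n : ℤ} {e : Edge d} (he : e ∈ box d 0 n) {t : ℝ}
    (ht : t ∈ Ioo 0 ε) : ‖edgePoint ε e t‖ ^ 2 ≤ d * (n * ε) ^ 2 := by
  rw [mem_box] at he
  rw [EuclideanSpace.real_norm_sq_eq]
  calc _ ≤ ∑ _j : Fin d, (n * ε) ^ 2 := by
        refine Finset.sum_le_sum fun j _ => ?_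
        have h0 : (0 : ℝ) ≤ if j = e.2 then t else 0 := by split_ifs <;> linarith [ht.1]
        have h1 : (if j = e.2 then t else 0) ≤ ε := by split_ifs <;> linarith [ht.2]
        have h2 : (0 : ℝ) ≤ e.1 j := by exact_mod_cast (he j).1
        have h3 : (e.1 j : ℝ) + 1 ≤ n := by exact_mod_cast (he j).2
        rw [edgePoint_apply]
        gcongr
        nlinarith
    _ = _ := by simp

theorem onEdge_bump (R h : ℝ) (e : Edge d) {t : ℝ} (ht : t ∈ Ioo 0 ε) :
    onEdge (fun x : grid d ε => bump R h x.1) e t = bump R h (edgePoint ε e t) :=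
  onEdge_of_mem (Ioo_subset_Icc_self ht)

theorem lpPow_bump_le (hε : 0 < ε) {n : ℤ} (hn : 0 < n) {h q : ℝ} (hh : 0 ≤ h) (hq : 0 < q) :
    lpPow ε q (onEdge fun x : grid d ε => bump (n * ε) h x.1) ≤
      (box d (-n) n).card * (ENNReal.ofReal h ^ q * ENNReal.ofReal ε) := by
  have hR : 0 < n * ε := mul_pos (by exact_mod_cast hn) hε
  refine tsum_lintegral_le_of_box (fun e t ht => ?_) (fun e he t ht => ?_)
  · rw [onEdge_bump _ _ e ht, Real.enorm_of_nonneg (bump_nonneg hh _)]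
    gcongr
    exact bump_le hh _
  · rw [onEdge_bump _ _ e ht, bump, max_zero_eq_zero_of_le_norm hR (le_norm_edgePoint hε he ht)]
    simp [hq]

/-- The condition on `m` puts the cube `[0, m ε]^d` inside the ball of half the bump radius, where
the bump is at least `h / 2`. -/
theorem le_lpPow_bump (hε : 0 < ε) {n m : ℤ} (hn : 0 < n) (hnm : (d : ℝ) * m ^ 2 ≤ n ^ 2 / 4)
    {h q : ℝ} (hh : 0 ≤ h) (hq : 0 < q) :
    (box d 0 m).card * (ENNReal.ofReal (h / 2) ^ q * ENNReal.ofReal ε) ≤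
      lpPow ε q (onEdge fun x : grid d ε => bump (n * ε) h x.1) := by
  have hR : 0 < n * ε := mul_pos (by exact_mod_cast hn) hε
  refine le_tsum_lintegral_of_box (fun e he t ht => ?_)
  rw [onEdge_bump _ _ e ht, Real.enorm_of_nonneg (bump_nonneg hh _)]
  gcongr
  refine half_le_bump hR hh ((norm_edgePoint_sq_le hε he ht).trans ?_)
  rw [mul_pow, mul_pow]
  nlinarith [sq_nonneg ε]

theorem lpPow_bumpDer_le (hε : 0 < ε) {n : ℤ} (hn : 0 < n) {h : ℝ} (hh : 0 ≤ h) :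
    lpPow ε 2 (bumpDer (d := d) ε (n * ε) h) ≤
      (box d (-n) n).card * (ENNReal.ofReal (4 * h / (n * ε)) ^ (2 : ℝ) * ENNReal.ofReal ε) := by
  have hR : 0 < n * ε := mul_pos (by exact_mod_cast hn) hε
  refine tsum_lintegral_le_of_box (fun e t ht => ?_) (fun e he t ht => ?_)
  · rw [Real.enorm_eq_ofReal_abs]
    gcongr
    exact abs_bumpDer_le hR hh _ _
  · rw [bumpDer, max_zero_eq_zero_of_le_norm hR (le_norm_edgePoint hε he ht)]
    simp

/-- The bump function, as an element of the Sobolev space of the grid. -/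
def bumpH1 (d : ℕ) (hε : 0 < ε) {n : ℤ} (hn : 0 < n) {h : ℝ} (hh : 0 ≤ h) : H1 d ε where
  toFun x := bump (n * ε) h x.1
  der := bumpDer ε (n * ε) h
  continuous_toFun := (bump_continuous _ _).comp continuous_subtype_val
  aestronglyMeasurable_der e := (bumpDer_continuous _ _ e).aestronglyMeasurable
  isWeakDeriv e := isWeakDeriv_of_hasDerivAt hε.le (fun _ ht => onEdge_bump _ _ e ht)
    (hasDerivAt_bump _ _ e) (bumpDer_continuous _ _ e)
  lpPow_toFun_lt_top := (lpPow_bump_le hε hn hh two_pos).trans_lt <| by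
    exact ENNReal.mul_lt_top (by simp) (ENNReal.mul_lt_top
      (ENNReal.rpow_lt_top_of_nonneg (by simp) (by simp)) (by simp))
  lpPow_der_lt_top := (lpPow_bumpDer_le hε hn hh).trans_lt <| by
    exact ENNReal.mul_lt_top (by simp) (ENNReal.mul_lt_top
      (ENNReal.rpow_lt_top_of_nonneg (by simp) (by simp)) (by simp))

theorem normPow_bumpH1_le (hε : 0 < ε) {n : ℤ} (hn : 0 < n) {h q : ℝ} (hh : 0 ≤ h)
    (hq : 0 < q) :
    (bumpH1 d hε hn hh).normPow q ≤ (box d (-n) n).card * (h ^ q * ε) := by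
  have := lpPow_bump_le (d := d) hε hn hh hq
  refine (ENNReal.toReal_mono ?_ this).trans_eq ?_
  · exact (ENNReal.mul_lt_top (by simp) (ENNReal.mul_lt_top
      (ENNReal.rpow_lt_top_of_nonneg hq.le (by simp)) (by simp))).ne
  · simp [ENNReal.toReal_mul, ← ENNReal.toReal_rpow, hh, hε.le]

theorem le_normPow_bumpH1 (hε : 0 < ε) {n m : ℤ} (hn : 0 < n)
    (hnm : (d : ℝ) * m ^ 2 ≤ n ^ 2 / 4) {h q : ℝ} (hh : 0 ≤ h) (hq : 0 < q) :
    (box d 0 m).card * ((h / 2) ^ q * ε) ≤ (bumpH1 d hε hn hh).normPow q := by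
  have := le_lpPow_bump (d := d) hε hn hnm hh hq
  refine le_trans (le_of_eq ?_) (ENNReal.toReal_mono ?_ this)
  · have : 0 ≤ h / 2 := by positivity
    rw [ENNReal.toReal_mul, ENNReal.toReal_mul, ← ENNReal.toReal_rpow,
      ENNReal.toReal_ofReal this, ENNReal.toReal_ofReal hε.le, ENNReal.toReal_natCast]
  · exact ((lpPow_bump_le hε hn hh hq).trans_lt (ENNReal.mul_lt_top (by simp)
      (ENNReal.mul_lt_top (ENNReal.rpow_lt_top_of_nonneg hq.le (by simp)) (by simp)))).ne

theorem derNormSq_bumpH1_le (hε : 0 < ε) {n : ℤ} (hn : 0 < n) {h : ℝ} (hh : 0 ≤ h) :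
    (bumpH1 d hε hn hh).derNormSq ≤ (box d (-n) n).card * ((4 * h / (n * ε)) ^ 2 * ε) := by
  have := lpPow_bumpDer_le (d := d) hε hn hh
  have hR : 0 < n * ε := mul_pos (by exact_mod_cast hn) hε
  refine (ENNReal.toReal_mono ?_ this).trans_eq ?_
  · exact (ENNReal.mul_lt_top (by simp) (ENNReal.mul_lt_top
      (ENNReal.rpow_lt_top_of_nonneg (by simp) (by simp)) (by simp))).ne
  · have : 0 ≤ 4 * h / (n * ε) := by positivity
    rw [ENNReal.toReal_mul, ENNReal.toReal_mul, ← ENNReal.toReal_rpow,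
      ENNReal.toReal_ofReal this, ENNReal.toReal_ofReal hε.le, ENNReal.toReal_natCast,
      Real.rpow_two]

/-- Allows any mass to be prescribed by adjusting the height alone. -/
theorem normPow_two_bumpH1 (hε : 0 < ε) {n : ℤ} (hn : 0 < n) {h : ℝ} (hh : 0 ≤ h) :
    (bumpH1 d hε hn hh).normPow 2 = h ^ 2 * (bumpH1 d hε hn zero_le_one).normPow 2 := by
  have : lpPow ε 2 (onEdge fun x : grid d ε => bump (n * ε) h x.1) =
      ENNReal.ofReal h ^ (2 : ℝ) * lpPow ε 2 (onEdge fun x : grid d ε => bump (n * ε) 1 x.1) := by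
    rw [lpPow, lpPow, ← ENNReal.tsum_mul_left]
    refine tsum_congr fun e => ?_
    rw [← lintegral_const_mul' _ _ (ENNReal.rpow_ne_top_of_nonneg zero_le_two (by simp))]
    refine setLIntegral_congr_fun measurableSet_Ioo fun t ht => ?_
    simp only [onEdge_bump _ _ e ht]
    rw [← ENNReal.mul_rpow_of_nonneg _ _ zero_le_two, ← Real.enorm_of_nonneg hh, ← enorm_mul]
    simp [bump]
  have h2 := congrArg ENNReal.toReal this
  rw [ENNReal.toReal_mul, ← ENNReal.toReal_rpow, ENNReal.toReal_ofReal hh, Real.rpow_two] at h2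
  exact h2

/-- A bump function of prescribed mass whose support and plateau have size of order `m ε`. -/
theorem exists_bump_of_mass (hd : 1 ≤ d) (hε : 0 < ε) {m : ℕ} (hm : 0 < m) {M p : ℝ} (hM : 0 < M)
    (hp : 0 < p) :
    ∃ v ∈ H1mass d ε M, ∃ h > 0, M ≤ h ^ 2 * ((4 * d) ^ d * (d * m ^ d * ε)) ∧
      v.derNormSq ≤ (4 * h / (2 * d * (m * ε))) ^ 2 * ((4 * d) ^ d * (d * m ^ d * ε)) ∧
      (h / 2) ^ p * (d * m ^ d * ε) ≤ v.normPow p := by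
  have hd0 : (1 : ℝ) ≤ d := by exact_mod_cast hd
  have hm0 : (0 : ℝ) < m := by exact_mod_cast hm
  -- With `n = 2dm`, `d m² ≤ d² m² = n² / 4`, as the plateau bound requires; the outer box has side
  -- `4dm`, whence the factor `(4d)^d`.
  have hn : (0 : ℤ) < ((2 * d * m : ℕ) : ℤ) := by positivity
  have hnm : (d : ℝ) * ((m : ℤ) : ℝ) ^ 2 ≤ (((2 * d * m : ℕ) : ℤ) : ℝ) ^ 2 / 4 := by
    push_cast
    nlinarith [sq_nonneg (m : ℝ), mul_nonneg (mul_nonneg (sub_nonneg.2 hd0) (by positivity :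
      (0 : ℝ) ≤ d)) (sq_nonneg (m : ℝ))]
  have hin : ((box d 0 (m : ℤ)).card : ℝ) = m ^ d * d := by
    rw [card_box]; push_cast; simp
  have hout : ((box d (-((2 * d * m : ℕ) : ℤ)) ((2 * d * m : ℕ) : ℤ)).card : ℝ) =
      (4 * d * m) ^ d * d := by
    rw [card_box]
    have : (((2 * d * m : ℕ) : ℤ) - -((2 * d * m : ℕ) : ℤ)).toNat = 4 * d * m := by
      have : ((2 * d * m : ℕ) : ℤ) - -((2 * d * m : ℕ) : ℤ) = ((4 * d * m : ℕ) : ℤ) := by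
        push_cast; ring
      rw [this, Int.toNat_natCast]
    rw [this]; push_cast; ring
  set S := (bumpH1 d hε hn zero_le_one).normPow 2 with hS
  have hS0 : 0 < S := by
    refine lt_of_lt_of_le ?_ (le_normPow_bumpH1 hε hn hnm zero_le_one two_pos)
    rw [hin]; positivity
  have hh : 0 < √(M / S) := Real.sqrt_pos.2 (by positivity)
  have hmass : (bumpH1 d hε hn hh.le).normPow 2 = M := by
    rw [normPow_two_bumpH1, Real.sq_sqrt (by positivity), ← hS]; field_simp
  refine ⟨bumpH1 d hε hn hh.le, hmass, √(M / S), hh, ?_, ?_, ?_⟩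
  · have h1 := normPow_bumpH1_le (d := d) hε hn hh.le two_pos
    rw [hmass, hout, Real.rpow_two] at h1
    refine h1.trans_eq ?_
    rw [mul_pow _ (m : ℝ)]; ring
  · refine (derNormSq_bumpH1_le (d := d) hε hn hh.le).trans_eq ?_
    rw [hout, mul_pow _ (m : ℝ)]; push_cast; ring
  · refine le_trans (le_of_eq ?_) (le_normPow_bumpH1 (d := d) hε hn hnm hh.le hp)
    rw [hin]; ring

/-! ### Estimates uniform in the edgelength. -/

/-- The Gagliardo–Nirenberg inequality on grids, uniform in the edgelength at the mass scaling
`d μ / ε ^ (d - 1)`. -/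
theorem exists_normPow_le_mul_rpow {d : ℕ} (hd : 2 ≤ d) {p : ℝ} (hp : 2 < p)
    (hp' : p < 2 + 4 / (d : ℝ)) {μ : ℝ} (hμ : 0 < μ) :
    ∃ K > 0, ∀ ε : ℝ, 0 < ε → ∀ u : H1 d ε, u.normPow 2 = d / ε ^ (d - 1) * μ →
      ε ^ (d - 1) * u.normPow p ≤ K * (ε ^ (d - 1) * u.derNormSq) ^ ((d : ℝ) * (p - 2) / 4) := by
  have hd2 : (2 : ℝ) ≤ d := by exact_mod_cast hd
  have hd1 : (0 : ℝ) < d - 1 := by linarith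
  have hd0 : (0 : ℝ) < d := by linarith
  set b : ℝ := (d : ℝ) * (p - 2) / 4 with hb
  have hb0 : 0 < b := by rw [hb]; have : 0 < p - 2 := by linarith
                         positivity
  have hb1 : b < 1 := by
    have : p - 2 < 4 / d := by linarith
    rw [lt_div_iff₀ hd0] at this
    rw [hb, div_lt_one (by norm_num)]; linarith
  have hdiv : 2 / (d : ℝ) ≤ 1 := by rw [div_le_one hd0]; exact hd2
  set Γ : ℝ := 4 * (d + 2) * (d - 1) / (d : ℝ) ^ 2 with hΓ
  have hΓ0 : 0 < Γ := by positivity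
  set K₀ : ℝ := (d : ℝ) ^ (2 - 2 / (d : ℝ)) * Γ ^ (2 : ℝ) * (d * μ) ^ (2 / (d : ℝ)) with hK₀
  have hK₀0 : 0 < K₀ := by positivity
  refine ⟨(d * μ) ^ (1 - b) * K₀ ^ b, by positivity, fun ε hε u hu => ?_⟩
  set s : ℝ := ε ^ (d - 1) with hs
  have hs0 : 0 < s := by positivity
  have hder0 : 0 ≤ u.derNormSq := ENNReal.toReal_nonneg
  have hm : u.normPow 2 = d * μ / s := by rw [hu]; ring
  have hcrit : u.normPow (2 + 4 / (d : ℝ)) ≤ K₀ * u.derNormSq := by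
    have h1 := u.lpPow_critical_le hd hε
    -- This power of `ε` exactly cancels the `s ^ (-2/d)` coming from the mass `d μ / s`, so `K₀` is
    -- independent of `ε`.
    have hsε : (ε ^ (2 - 2 / (d : ℝ))) = s ^ (2 / (d : ℝ)) := by
      rw [hs, ← Real.rpow_natCast, ← Real.rpow_mul hε.le, Nat.cast_sub (by omega)]
      congr 1; push_cast; field_simp
    have h2 : 0 ≤ 2 - 2 / (d : ℝ) := by linarith
    refine (ENNReal.toReal_mono ?_ h1).trans_eq ?_
    · refine (ENNReal.mul_lt_top (ENNReal.mul_lt_top ?_ ?_) (ENNReal.mul_lt_top ?_ ?_)).ne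
      · exact ENNReal.rpow_lt_top_of_nonneg h2 (ENNReal.mul_ne_top (by simp) (by simp))
      · exact ENNReal.rpow_lt_top_of_nonneg zero_le_two (by simp)
      · exact ENNReal.rpow_lt_top_of_nonneg (by positivity) u.lpPow_toFun_lt_top.ne
      · exact u.lpPow_der_lt_top
    · rw [ENNReal.toReal_mul, ENNReal.toReal_mul, ENNReal.toReal_mul, ← ENNReal.toReal_rpow,
        ← ENNReal.toReal_rpow, ← ENNReal.toReal_rpow, ENNReal.toReal_mul, ENNReal.toReal_natCast,
        ENNReal.toReal_ofReal hε.le, ENNReal.toReal_ofReal hΓ0.le]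
      change _ * _ * (u.normPow 2 ^ _ * u.derNormSq) = _
      rw [hm, Real.mul_rpow hd0.le hε.le, hsε, Real.div_rpow (by positivity) hs0.le, hK₀]
      have : 0 < s ^ (2 / (d : ℝ)) := by positivity
      field_simp
  have hint : u.normPow p ≤ u.normPow 2 ^ (1 - b) * u.normPow (2 + 4 / (d : ℝ)) ^ b := by
    have h1 := u.lpPow_interpolate (q₀ := 2) (q₁ := 2 + 4 / (d : ℝ)) (θ := b) (by norm_num)
      (by positivity) hb0.le hb1.le
    have h2 : 2 * (1 - b) + (2 + 4 / (d : ℝ)) * b = p := by rw [hb]; field_simp; ring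
    rw [h2] at h1
    have h3 := ENNReal.toReal_mono (ENNReal.mul_ne_top
      (ENNReal.rpow_ne_top_of_nonneg (by linarith) u.lpPow_toFun_lt_top.ne)
      (ENNReal.rpow_ne_top_of_nonneg hb0.le (u.lpPow_ne_top hε
        (by linarith [div_nonneg zero_le_four hd0.le])))) h1
    rwa [ENNReal.toReal_mul, ← ENNReal.toReal_rpow, ← ENNReal.toReal_rpow] at h3
  have hX0 : 0 ≤ u.normPow (2 + 4 / (d : ℝ)) := ENNReal.toReal_nonneg
  calc s * u.normPow p
      ≤ s * (u.normPow 2 ^ (1 - b) * (K₀ * u.derNormSq) ^ b) := by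
        gcongr
        refine hint.trans ?_
        rw [hm]
        gcongr
    _ = _ := by
        have h1 : s = s ^ (1 - b) * s ^ b := by
          rw [← Real.rpow_add hs0]; simp
        rw [hm, Real.div_rpow (by positivity) hs0.le, Real.mul_rpow hK₀0.le hder0,
          Real.mul_rpow hs0.le hder0]
        nth_rw 1 [h1]
        have : 0 < s ^ (1 - b) := by positivity
        field_simp

/-- For small edgelength the infimum of the energy is negative, of the order of the mass. -/
theorem exists_energy_le {d : ℕ} (hd : 1 ≤ d) {p : ℝ} (hp : 2 < p)
    (hp' : p < 2 + 4 / (d : ℝ)) {μ : ℝ} (hμ : 0 < μ) :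
    ∃ ε₀ > 0, ∃ c > 0, ∀ ε : ℝ, 0 < ε → ε < ε₀ →
      ∃ v ∈ H1mass d ε (d / ε ^ (d - 1) * μ), ε ^ (d - 1) * energy p v ≤ -c := by
  have hd0 : (0 : ℝ) < d := by exact_mod_cast hd
  have hp0 : 0 < p := by linarith
  set Q : ℝ := (4 * d) ^ d with hQ
  have hQ0 : 0 < Q := by positivity
  -- For a bump of size `ρ` at the prescribed mass, `h²` is at least of order `ρ ^ (-d)`. Relative
  -- to `h² V` the kinetic term is of order `ρ ^ (-2)` and the potential term at least of order `ρ ^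
  -- (-d(p-2)/2)`; `τ` is the gain exponent, positive by subcriticality.
  set τ : ℝ := 2 - d * ((p - 2) / 2) with hτ
  have hτ0 : 0 < τ := by
    have : p - 2 < 4 / d := by linarith
    rw [lt_div_iff₀ hd0] at this
    rw [hτ]; linarith
  set κ : ℝ := 1 / (d * p) * (1 / 2) ^ p * (μ / Q) ^ ((p - 2) / 2) with hκ
  have hκ0 : 0 < κ := by positivity
  obtain ⟨L, hL1, hL⟩ : ∃ L : ℝ, 1 ≤ L ∧ ∀ ρ ≥ L, 2 * Q / d ^ 2 + 1 ≤ κ * ρ ^ τ := by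
    have := ((tendsto_rpow_atTop hτ0).const_mul_atTop hκ0).eventually_ge_atTop
      (2 * Q / d ^ 2 + 1)
    obtain ⟨L, hL⟩ := Filter.eventually_atTop.1 this
    exact ⟨max 1 L, le_max_left _ _, fun ρ hρ => hL ρ ((le_max_right _ _).trans hρ)⟩
  refine ⟨L, by linarith, d * μ / Q / (2 * L) ^ 2, by positivity, fun ε hε hεL => ?_⟩
  -- The rounded size `ρ = m ε` stays in `[L, 2L]` when `ε < L`: the lower bound makes the potential
  -- term win, the upper one keeps `c` independent of `ε`.
  set m : ℕ := ⌈L / ε⌉₊ with hm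
  have hmpos : 0 < m := Nat.ceil_pos.2 (by positivity)
  have hm0 : (0 : ℝ) < m := by exact_mod_cast hmpos
  set ρ : ℝ := m * ε with hρ
  have hρL : L ≤ ρ := by
    have := Nat.le_ceil (L / ε)
    rw [div_le_iff₀ hε] at this
    exact this
  have hρL2 : ρ ≤ 2 * L := by
    have h1 := (Nat.ceil_lt_add_one (a := L / ε) (by positivity)).le
    have h2 : ρ ≤ (L / ε + 1) * ε := by rw [hρ]; gcongr
    have h3 : (L / ε + 1) * ε = L + ε := by field_simp
    linarith
  have hρ0 : 0 < ρ := by positivity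
  set s : ℝ := ε ^ (d - 1) with hs
  have hs0 : 0 < s := by positivity
  obtain ⟨v, hv, h, hh, hmass, hder, hpow⟩ := exists_bump_of_mass hd hε hmpos
    (M := d / s * μ) (p := p) (by positivity) hp0
  refine ⟨v, hv, ?_⟩
  set V : ℝ := d * m ^ d * ε with hV
  have hV0 : 0 < V := by positivity
  have hsV : s * V = d * ρ ^ d := by
    have : s * ε = ε ^ d := by rw [hs, ← pow_succ]; congr 1; omega
    calc s * V = d * m ^ d * (s * ε) := by rw [hV]; ring
      _ = _ := by rw [this, hρ, mul_pow]; ring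
  have hmass' : d * μ ≤ h ^ 2 * Q * (s * V) := by
    have h1 := mul_le_mul_of_nonneg_left hmass hs0.le
    have h2 : s * (d / s * μ) = d * μ := by field_simp
    rw [h2] at h1
    linarith
  have hh2 : μ / Q / ρ ^ d ≤ h ^ 2 := by
    rw [hsV] at hmass'
    rw [div_div, div_le_iff₀ (by positivity)]
    have : d * μ ≤ d * (h ^ 2 * (Q * ρ ^ d)) := by linarith
    exact le_of_mul_le_mul_left this hd0
  have hhp : (μ / Q) ^ ((p - 2) / 2) * ρ ^ τ ≤ h ^ (p - 2) * ρ ^ 2 := by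
    have h1 : (μ / Q / ρ ^ d) ^ ((p - 2) / 2) ≤ (h ^ 2) ^ ((p - 2) / 2) := by
      have : 0 ≤ (p - 2) / 2 := by linarith
      gcongr
    have h2 : (h ^ 2) ^ ((p - 2) / 2) = h ^ (p - 2) := by
      rw [← Real.rpow_natCast, ← Real.rpow_mul hh.le]; congr 1; push_cast; ring
    rw [h2, Real.div_rpow (by positivity) (by positivity)] at h1
    have h3 : ρ ^ τ = ρ ^ 2 / (ρ ^ d) ^ ((p - 2) / 2) := by
      rw [hτ, Real.rpow_sub hρ0, ← Real.rpow_natCast ρ d, ← Real.rpow_mul hρ0.le, Real.rpow_two]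
    calc _ = (μ / Q) ^ ((p - 2) / 2) / (ρ ^ d) ^ ((p - 2) / 2) * ρ ^ 2 := by rw [h3]; ring
      _ ≤ _ := by gcongr
  have hhp2 : (h / 2) ^ p = h ^ 2 * ((1 / 2) ^ p * h ^ (p - 2)) := by
    rw [div_eq_mul_one_div, Real.mul_rpow hh.le (by norm_num), Real.rpow_sub hh, Real.rpow_two]
    field_simp
  have hbr : 1 / 2 * (4 / (2 * d * ρ)) ^ 2 * Q - 1 / (d * p) * ((1 / 2) ^ p * h ^ (p - 2)) ≤
      -(1 / ρ ^ 2) := by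
    have h1 := hL ρ hρL
    have h2 : κ * ρ ^ τ ≤ 1 / (d * p) * ((1 / 2) ^ p * h ^ (p - 2)) * ρ ^ 2 := by
      calc κ * ρ ^ τ = 1 / (d * p) * (1 / 2) ^ p * ((μ / Q) ^ ((p - 2) / 2) * ρ ^ τ) := by
            rw [hκ]; ring
        _ ≤ 1 / (d * p) * (1 / 2) ^ p * (h ^ (p - 2) * ρ ^ 2) := by gcongr
        _ = _ := by ring
    have h3 : 1 / 2 * (4 / (2 * d * ρ)) ^ 2 * Q * ρ ^ 2 = 2 * Q / d ^ 2 := by field_simp; ring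
    refine le_of_mul_le_mul_right ?_ (by positivity : 0 < ρ ^ 2)
    rw [sub_mul, h3]
    have h4 : -(1 / ρ ^ 2) * ρ ^ 2 = -1 := by field_simp
    linarith
  have hE : energy p v ≤ h ^ 2 * V * (-(1 / ρ ^ 2)) := by
    calc energy p v ≤ 1 / 2 * ((4 * h / (2 * d * ρ)) ^ 2 * (Q * V)) -
          1 / (d * p) * ((h / 2) ^ p * V) := by
          unfold energy
          gcongr
      _ = h ^ 2 * V * (1 / 2 * (4 / (2 * d * ρ)) ^ 2 * Q -
          1 / (d * p) * ((1 / 2) ^ p * h ^ (p - 2))) := by rw [hhp2]; ring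
      _ ≤ _ := by gcongr
  calc s * energy p v ≤ s * (h ^ 2 * V * (-(1 / ρ ^ 2))) := by gcongr
    _ = -(h ^ 2 * (s * V) / ρ ^ 2) := by ring
    _ ≤ _ := by
        rw [neg_le_neg_iff]
        have : d * μ / Q ≤ h ^ 2 * (s * V) := by rw [div_le_iff₀ hQ0]; linarith
        gcongr

end MetricGrid

end

/-! ### Two-sided bounds for ground states. -/

theorem theorem5p2 (d : ℕ) (hd : 2 ≤ d) (p : ℝ) (hp : 2 < p) (hp' : p < 2 + 4 / (d : ℝ))
    (μ : ℝ) (hμ : 0 < μ) :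
    ∃ ε₀ > (0 : ℝ), ∃ C > (0 : ℝ), ∀ ε : ℝ, 0 < ε → ε < ε₀ →
      ∀ u : MetricGrid.H1 d ε,
        MetricGrid.IsGroundState p ((d : ℝ) / ε ^ (d - 1) * μ) u →
          (1 / C ≤ ε ^ (d - 1) * u.derNormSq ∧ ε ^ (d - 1) * u.derNormSq ≤ C) ∧
          (1 / C ≤ ε ^ (d - 1) * u.normPow p ∧ ε ^ (d - 1) * u.normPow p ≤ C) := by
  have hd0 : (0 : ℝ) < d := by exact_mod_cast (by omega : 0 < d)
  have hp0 : 0 < p := by linarith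
  obtain ⟨K, hK, hGN⟩ := MetricGrid.exists_normPow_le_mul_rpow hd hp hp' hμ
  obtain ⟨ε₀, hε₀, c, hc, hcomp⟩ := MetricGrid.exists_energy_le (by omega) hp hp' hμ
  set b : ℝ := (d : ℝ) * (p - 2) / 4 with hb
  have hb0 : 0 < b := by
    have : 0 < p - 2 := by linarith
    positivity
  have hb1 : b < 1 := by
    have : p - 2 < 4 / d := by linarith
    rw [lt_div_iff₀ hd0] at this
    rw [hb, div_lt_one (by norm_num)]; linarith
  have hb1' : 0 < 1 - b := by linarith
  set A₁ : ℝ := (2 / (d * p) * K) ^ (1 / (1 - b)) with hA₁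
  set N₀ : ℝ := d * p * c with hN₀
  set A₀ : ℝ := (N₀ / K) ^ (1 / b) with hA₀
  have hA₁0 : 0 < A₁ := by positivity
  have hN₀0 : 0 < N₀ := by positivity
  have hA₀0 : 0 < A₀ := by positivity
  set C : ℝ := A₁ + 1 / A₀ + 1 / N₀ + K * A₁ ^ b with hC
  have h1 : 0 < 1 / A₀ := by positivity
  have h2 : 0 < 1 / N₀ := by positivity
  have h3 : 0 < K * A₁ ^ b := by positivity
  have hC0 : 0 < C := by positivity
  refine ⟨ε₀, hε₀, C, hC0, fun ε hε hεε u hu => ?_⟩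
  obtain ⟨v, hv, hEv⟩ := hcomp ε hε hεε
  have hEu : MetricGrid.energy p u ≤ MetricGrid.energy p v := hu.2 hv
  have hs0 : 0 < ε ^ (d - 1) := by positivity
  have hgn := hGN ε hε u hu.1
  have hE : ε ^ (d - 1) * MetricGrid.energy p u ≤ -c :=
    (mul_le_mul_of_nonneg_left hEu hs0.le).trans hEv
  have hD0 : 0 ≤ u.derNormSq := ENNReal.toReal_nonneg
  set A := ε ^ (d - 1) * u.derNormSq with hA
  set N := ε ^ (d - 1) * u.normPow p with hN
  have hA0 : 0 ≤ A := by positivity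
  have hEq : 1 / 2 * A - 1 / (d * p) * N ≤ -c := by
    refine le_trans (le_of_eq ?_) hE
    rw [hA, hN, MetricGrid.energy]; ring
  have hNA : d * p * c + d * p / 2 * A ≤ N := by
    have := mul_le_mul_of_nonneg_left hEq (by positivity : 0 ≤ d * p)
    have e : d * p * (1 / 2 * A - 1 / (d * p) * N) = d * p / 2 * A - N := by field_simp
    rw [e] at this
    linarith
  have hNlow : N₀ ≤ N := by
    have : 0 ≤ d * p / 2 * A := by positivity
    linarith
  have hAlow : A₀ ≤ A := by
    have h4 : N₀ / K ≤ A ^ b := by rw [div_le_iff₀ hK]; linarith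
    calc A₀ ≤ (A ^ b) ^ (1 / b) := by rw [hA₀]; gcongr
      _ = A := by rw [← Real.rpow_mul hA0, mul_one_div_cancel hb0.ne', Real.rpow_one]
  -- Positivity permits dividing `d p / 2 * A ≤ K * A ^ b` by `A ^ b`, which yields the upper bound.
  have hApos : 0 < A := hA₀0.trans_le hAlow
  have hAup : A ≤ A₁ := by
    have h4 : A ^ (1 - b) ≤ 2 / (d * p) * K := by
      have h5 : d * p / 2 * A ≤ K * A ^ b := by
        have : 0 < d * p * c := hN₀0
        linarith
      rw [Real.rpow_sub hApos, Real.rpow_one, div_le_iff₀ (by positivity)]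
      calc A = 2 / (d * p) * (d * p / 2 * A) := by field_simp
        _ ≤ 2 / (d * p) * (K * A ^ b) := by gcongr
        _ = _ := by ring
    calc A = (A ^ (1 - b)) ^ (1 / (1 - b)) := by
          rw [← Real.rpow_mul hA0, mul_one_div_cancel hb1'.ne', Real.rpow_one]
      _ ≤ A₁ := by rw [hA₁]; gcongr
  have hNup : N ≤ K * A₁ ^ b := hgn.trans (by gcongr)
  refine ⟨⟨?_, by linarith⟩, ?_, by linarith⟩
  · refine le_trans ?_ hAlow
    rw [one_div_le hC0 hA₀0]; linarith
  · refine le_trans ?_ hNlow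
    rw [one_div_le hC0 hN₀0]; linarith
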